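/- Let $\Gamma\subset\mathbb R^2$ be a simple closed curve with a regular ($\mathbf x'(t)\neq 0$), real analytic, $2\pi$-periodic, counterclockwise parametrization $\mathbf x=(x_1,x_2):\mathbb R\to\mathbb R^2$, injective on $[0,2\pi)$, and let $\mathbf n=(x_2',-x_1')/|\mathbf x'|$ be its unit normal. Let $\phi:\mathbb R\to\mathbb R$ be real analytic and $2\pi$-periodic, and let $$\tilde S[\phi](t)=-\frac1{2\pi}\int_0^{2\pi}\log|\mathbf x(t)-\mathbf x(\tau)|\,\phi(\tau)\,|\mathbf x'(\tau)|\,d\tau$$ be the single-layer operator of the Laplace equation in parameter space. Let $M\ge 0$ be an integer and let $U_S:\mathbb R^2\times\Gamma\to\mathbb R$ be such that $U_S(\cdot,\mathbf x(t))$ is harmonic in $\mathbb R^2$ for all $t\in[0,2\pi]$. Write $P_S(\tau,t)=U_S(\mathbf x(\tau),\mathbf x(t))$ and $Q_S(\tau,t)=\nabla U_S(\mathbf x(\tau),\mathbf x(t))\cdot\mathbf n(\tau)$ (gradient in the first variable) for its Dirichlet and Neumann traces, and suppose that for all $t\in[0,2\pi]$ $$\lim_{\tau\to t}\frac{\partial^m}{\partial\tau^m}\{Q_S(\tau,t)-\phi(\tau)\}=0,\qquad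 m=0,\dots,M.$$ Then for every $t\in[0,2\pi]$ the integral defining $\tilde S[\phi](t)$ converges absolutely and $$\tilde S[\phi](t)=\frac{P_S(t,t)}2+\int_0^{2\pi}\left\{R_S^{(P)}(\tau,t)+R_S^{(Q)}(\tau,t)\right\}|\mathbf x'(\tau)|\,d\tau,$$ where $$R_S^{(P)}(\tau,t)=\begin{cases}\dfrac1{2\pi}\dfrac{\{\mathbf x(t)-\mathbf x(\tau)\}\cdot\mathbf n(\tau)}{|\mathbf x(t)-\mathbf x(\tau)|^2}P_S(\tau,t)&\text{if }\tau\not\equiv t \pmod{2\pi},\\[2ex] \dfrac{\mathbf x''(t)\cdot\mathbf n(t)}{4\pi|\mathbf x'(t)|^2}P_S(t,t)&\text{if }\tau\equiv t\pmod{2\pi},\end{cases}$$ $$R_S^{(Q)}(\tau,t)=\begin{cases}-\dfrac1{2\pi}\log|\mathbf x(t)-\mathbf x(\tau)|\,\{\phi(\tau)-Q_S(\tau,t)\}&\text{if }\tau\not\equiv t\pmod{2\pi},\\[1ex] 0&\text{if }\tau\equiv t\pmod{2\pi}.\end{cases}$$ Moreover, for every $t\in[0,2\pi]$: the function $R_S^{(P)}(\cdot,t)$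 is real analytic and $2\pi$-periodic on $\mathbb R$; the function $R_S^{(Q)}(\cdot,t)$ is $M$ times continuously differentiable and $2\pi$-periodic on $\mathbb R$; and the $(M+1)$-th derivative of $R_S^{(Q)}(\cdot,t)$ exists at all $\tau\not\equiv t\pmod{2\pi}$, is integrable over $[0,2\pi]$, and is $O(\log|\tau-t|)$ as $\tau\to t$. -/

import Mathlib

noncomputable section

namespace LayerPotential

/-- The Euclidean plane `ℝ²`. -/
abbrev Plane : Type := EuclideanSpace ℝ (Fin 2)

/-- Winding number about `p` of the closed curve parametrized by `x` on `[0, 2π]`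
(meaningful for `p` not on the curve). -/
def windingNumber (x : ℝ → Plane) (p : Plane) : ℝ :=
  (1 / (2 * Real.pi)) * ∫ τ in (0 : ℝ)..(2 * Real.pi),
    ((x τ 0 - p 0) * deriv x τ 1 - (x τ 1 - p 1) * deriv x τ 0) / ‖x τ - p‖ ^ 2

/-- `x` is a regular, analytic, `2π`-periodic, counterclockwise parametrization of a simple closed
curve in the plane. -/
structure IsAnalyticJordanParam (x : ℝ → Plane) : Prop where
  analytic : AnalyticOnNhd ℝ x Set.univ
  periodic : Function.Periodic x (2 * Real.pi)
  regular : ∀ τ, deriv x τ ≠ 0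
  simple : Set.InjOn x (Set.Ico 0 (2 * Real.pi))
  /-- The winding number of a simple closed curve is `0` about every exterior point and has
  the same value, `1` or `-1`, about every interior point; it is `1` exactly if the curve is
  run through counterclockwise. -/
  counterclockwise : ∃ p : Plane, p ∉ Set.range x ∧ windingNumber x p = 1

/-- The unit normal `(x₂', -x₁') / |x'|`, which points outward on a counterclockwise curve. -/
def unitNormal (x : ℝ → Plane) (τ : ℝ) : Plane :=
  ‖deriv x τ‖⁻¹ • !₂[deriv x τ 1, -(deriv x τ 0)]

/-- The free-space Green function of the Laplace equation in the plane. -/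
def green (y z : Plane) : ℝ := -(1 / (2 * Real.pi)) * Real.log ‖y - z‖

/-- The integrand of the single-layer operator in parameter space. -/
def singleLayerIntegrand (x : ℝ → Plane) (φ : ℝ → ℝ) (t τ : ℝ) : ℝ :=
  green (x t) (x τ) * φ τ * ‖deriv x τ‖

/-- The single-layer operator in parameter space. -/
def singleLayer (x : ℝ → Plane) (φ : ℝ → ℝ) (t : ℝ) : ℝ :=
  ∫ τ in (0 : ℝ)..(2 * Real.pi), singleLayerIntegrand x φ t τ

/-- The Dirichlet trace `P(τ, t)` of `U(·, x(t))`. -/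
def dirichletTrace (x : ℝ → Plane) (U : Plane → Plane → ℝ) (τ t : ℝ) : ℝ :=
  U (x τ) (x t)

/-- The Neumann trace `Q(τ, t)` of `U(·, x(t))`. -/
def neumannTrace (x : ℝ → Plane) (U : Plane → Plane → ℝ) (τ t : ℝ) : ℝ :=
  inner ℝ (gradient (fun z => U z (x t)) (x τ)) (unitNormal x τ)

/-- `τ` and `t` are the same parameter modulo the period `2π`. -/
def SameParam (τ t : ℝ) : Prop := ∃ k : ℤ, τ = t + k * (2 * Real.pi)

open Classical in
/-- The kernel `R^{(P)}(τ, t)`. -/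
def kernelP (x : ℝ → Plane) (U : Plane → Plane → ℝ) (τ t : ℝ) : ℝ :=
  if SameParam τ t then
    inner ℝ (deriv (deriv x) t) (unitNormal x t) / (4 * Real.pi * ‖deriv x t‖ ^ 2)
      * dirichletTrace x U t t
  else
    (1 / (2 * Real.pi)) * (inner ℝ (x t - x τ) (unitNormal x τ) / ‖x t - x τ‖ ^ 2)
      * dirichletTrace x U τ t

open Classical in
/-- The kernel `R^{(Q)}(τ, t)`. -/
def kernelQ (x : ℝ → Plane) (φ : ℝ → ℝ) (U : Plane → Plane → ℝ) (τ t : ℝ) : ℝ :=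
  if SameParam τ t then 0
  else -(1 / (2 * Real.pi)) * Real.log ‖x t - x τ‖ * (φ τ - neumannTrace x U τ t)

end LayerPotential

end

/-! After identifying the plane with `ℂ`, a harmonic `U(·, x(t))` is the real part of an entire `F`,
and |z'| times its Neumann trace is Im(F'(z) z') by Cauchy–Riemann. Splitting φ = Q + (φ - Q) puts
the second summand into the kernel `kernelQ`. The first is treated by Green's third identity on the
curve (`integral_log_norm_sub_mul`), which here needs no area integral: if P is a primitive of (F -
F(z t))/(w - z t), then log|z - z t| · Im(F(z) - F(z t)) - Im P(z) is continuous and periodic, and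
its derivative is the difference of the two integrands, up to the constant Re F(z t) times the
angular density Im(z'/(z - z t)).

What remains is that this density has integral π (`totalAngle_eq_pi`). The divided difference of z
at t changes sign over one period, so the total is an odd multiple of π; by continuity it is
independent of t. A point off the curve can be moved along a normal towards its nearest curve point
without changing its winding angle, and in the limit this angle differs from the total by at most π.
Comparison with winding angles 2π and 0 leaves only π.

For the regularity, Im(z'/(z - z t)) has a removable singularity because the pole 1/(τ - t) is real.
By hypothesis φ - Q is analytic with a zero of order at least M + 1 at t, and (τ - t)^(M+1) log|τ -
t| has M continuous derivatives and a logarithmic (M+1)-th one. -/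

noncomputable section

namespace LayerPotential

open Real Set Filter Topology MeasureTheory intervalIntegral Asymptotics InnerProductSpace

/-! ### Analytic loops and their divided differences -/

/-- A regular, analytic, `2π`-periodic, simple closed curve in the complex plane. -/
structure IsAnalyticLoop (z : ℝ → ℂ) : Prop where
  analytic : ∀ τ, AnalyticAt ℝ z τ
  periodic : Function.Periodic z (2 * π)
  regular : ∀ τ, deriv z τ ≠ 0
  simple : InjOn z (Ico 0 (2 * π))

lemma analyticAt_dslope {𝕜 E : Type*} [NontriviallyNormedField 𝕜] [NormedAddCommGroup E]
    [NormedSpace 𝕜 E] {f : 𝕜 → E} {a b : 𝕜} (ha : AnalyticAt 𝕜 f a) (hb : AnalyticAt 𝕜 f b) :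
    AnalyticAt 𝕜 (dslope f a) b := by
  rcases eq_or_ne b a with rfl | h
  · obtain ⟨p, hp⟩ := ha
    exact hp.has_fpower_series_dslope_fslope.analyticAt
  · refine AnalyticAt.congr ?_ (dslope_eventuallyEq_slope_of_ne f h).symm
    have : slope f a = fun b => (b - a)⁻¹ • (f b - f a) := by
      ext b; simp [slope_def_module]
    rw [this]
    exact ((analyticAt_id.sub analyticAt_const).inv (sub_ne_zero.2 h)).smul
      (hb.sub analyticAt_const)

lemma SameParam.eq_of_abs_lt {τ t : ℝ} (h : SameParam τ t) (hlt : |τ - t| < 2 * π) : τ = t := by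
  obtain ⟨k, rfl⟩ := h
  have hk : |(k : ℝ)| < 1 := by
    have h1 : |t + k * (2 * π) - t| = |(k : ℝ)| * (2 * π) := by
      rw [add_sub_cancel_left, abs_mul, abs_of_pos two_pi_pos]
    rw [h1] at hlt
    nlinarith [two_pi_pos]
  have : k = 0 := by
    rw [← Int.cast_abs] at hk
    exact Int.abs_lt_one_iff.1 (by exact_mod_cast hk)
  simp [this]

lemma sub_eq_mul_dslope (z : ℝ → ℂ) (t τ : ℝ) :
    z τ - z t = ((τ - t : ℝ) : ℂ) * dslope z t τ := by
  rw [← sub_smul_dslope z t τ, Complex.real_smul]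

namespace IsAnalyticLoop

variable {z : ℝ → ℂ}

lemma eq_of_sameParam (hz : IsAnalyticLoop z) {τ t : ℝ} (h : SameParam τ t) : z τ = z t := by
  obtain ⟨k, rfl⟩ := h
  exact hz.periodic.int_mul k t

lemma eq_iff (hz : IsAnalyticLoop z) {τ t : ℝ} : z τ = z t ↔ SameParam τ t := by
  refine ⟨fun h => ?_, hz.eq_of_sameParam⟩
  have key : ∀ s, z (toIcoMod two_pi_pos 0 s) = z s := fun s => by
    rw [toIcoMod]; exact hz.periodic.sub_zsmul_eq _
  have hmem : ∀ s, toIcoMod two_pi_pos 0 s ∈ Ico 0 (2 * π) := fun s => by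
    simpa using toIcoMod_mem_Ico two_pi_pos 0 s
  have h1 := hz.simple (hmem τ) (hmem t) (by rw [key, key, h])
  rw [toIcoMod, toIcoMod] at h1
  refine ⟨toIcoDiv two_pi_pos 0 τ - toIcoDiv two_pi_pos 0 t, ?_⟩
  simp only [zsmul_eq_mul] at h1
  push_cast
  linarith

lemma differentiable (hz : IsAnalyticLoop z) : Differentiable ℝ z := fun τ =>
    (hz.analytic τ).differentiableAt

lemma continuous (hz : IsAnalyticLoop z) : Continuous z := hz.differentiable.continuous

lemma analyticAt_deriv (hz : IsAnalyticLoop z) (τ : ℝ) : AnalyticAt ℝ (deriv z) τ :=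
    (hz.analytic τ).deriv

lemma continuous_deriv (hz : IsAnalyticLoop z) : Continuous (deriv z) :=
  continuous_iff_continuousAt.2 fun τ => (hz.analyticAt_deriv τ).continuousAt

lemma periodic_deriv (hz : IsAnalyticLoop z) : Function.Periodic (deriv z) (2 * π) := fun τ => by
  have h : (fun s => z (s + 2 * π)) = z := funext hz.periodic
  rw [← deriv_comp_add_const, h]

lemma analyticAt_dslope (hz : IsAnalyticLoop z) (t τ : ℝ) : AnalyticAt ℝ (dslope z t) τ :=
  LayerPotential.analyticAt_dslope (hz.analytic t) (hz.analytic τ)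

/-- Regularity excludes a zero at τ = t, simplicity one elsewhere. The window cannot be enlarged:
the divided difference vanishes at t ± 2π. -/
lemma dslope_ne_zero (hz : IsAnalyticLoop z) {t τ : ℝ}
    (h : |τ - t| < 2 * π) : dslope z t τ ≠ 0 := by
  rcases eq_or_ne τ t with rfl | hne
  · rw [dslope_same]; exact hz.regular τ
  · intro h0
    have h1 := sub_smul_dslope z t τ
    rw [h0, smul_zero, eq_comm, sub_eq_zero, hz.eq_iff] at h1
    exact hne (h1.eq_of_abs_lt h)

lemma deriv_eq_dslope (hz : IsAnalyticLoop z) (t τ : ℝ) :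
    deriv z τ = dslope z t τ + (τ - t) * deriv (dslope z t) τ := by
  have h1 : z = fun s : ℝ => z t + ((s : ℂ) - t) * dslope z t s := by
    ext s
    have := sub_smul_dslope z t s
    simp only [Complex.real_smul, Complex.ofReal_sub] at this
    rw [this]; ring
  have h2 : HasDerivAt (fun s : ℝ => z t + ((s : ℂ) - t) * dslope z t s)
      (1 * dslope z t τ + ((τ : ℂ) - t) * deriv (dslope z t) τ) τ :=
    (((Complex.ofRealCLM.hasDerivAt.sub_const _).mul
      (hz.analyticAt_dslope t τ).differentiableAt.hasDerivAt).const_add _)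
  rw [← h1] at h2
  rw [h2.deriv, one_mul]

/-- The singular part of the logarithmic derivative is the real pole 1/(τ - t), so imaginary parts
stay regular. -/
lemma deriv_div_sub (hz : IsAnalyticLoop z) {t τ : ℝ} (hne : τ ≠ t) (h : |τ - t| < 2 * π) :
    deriv z τ / (z τ - z t) = ((τ - t : ℝ) : ℂ)⁻¹ + deriv (dslope z t) τ / dslope z t τ := by
  have h1 := hz.dslope_ne_zero h
  have h2 : ((τ - t : ℝ) : ℂ) ≠ 0 := by exact_mod_cast sub_ne_zero.2 hne
  rw [sub_eq_mul_dslope, hz.deriv_eq_dslope t τ]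
  push_cast at h2 ⊢
  field_simp

end IsAnalyticLoop

/-! ### The angle under which a loop is seen from its own point -/

/-- The derivative of the angle under which `z τ` is seen from `z t`. -/
def angleKernel (z : ℝ → ℂ) (t τ : ℝ) : ℝ := (deriv z τ / (z τ - z t)).im

/-- Total angle under which the loop `z` is seen from its own point `z t`. -/
def totalAngle (z : ℝ → ℂ) (t : ℝ) : ℝ := ∫ u in (-π)..π, angleKernel z t (t + u)

namespace IsAnalyticLoop

variable {z : ℝ → ℂ}

lemma angleKernel_eq (hz : IsAnalyticLoop z) {t τ : ℝ} (hne : τ ≠ t) (h : |τ - t| < 2 * π) :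
    angleKernel z t τ = (deriv (dslope z t) τ / dslope z t τ).im := by
  rw [angleKernel, hz.deriv_div_sub hne h, Complex.add_im, ← Complex.ofReal_inv,
    Complex.ofReal_im, zero_add]

end IsAnalyticLoop

lemma ae_restrict_ne {s : Set ℝ} (a : ℝ) : ∀ᵐ u ∂(volume : Measure ℝ).restrict s, u ≠ a :=
  ae_restrict_of_ae (by simp [ae_iff])

/-- The exponential of the integral of the logarithmic derivative of a nonvanishing curve is the
ratio of its end points. -/
lemma exp_integral_logDeriv {c c' : ℝ → ℂ} {a b : ℝ} (hab : a ≤ b)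
    (hc : ∀ τ ∈ Icc a b, HasDerivAt c (c' τ) τ) (hc' : ContinuousOn c' (Icc a b))
    (h0 : ∀ τ ∈ Icc a b, c τ ≠ 0) :
    Complex.exp (∫ τ in a..b, c' τ / c τ) = c b / c a := by
  have hcont : ContinuousOn (fun τ => c' τ / c τ) (Icc a b) :=
    hc'.div (fun τ hτ => (hc τ hτ).continuousAt.continuousWithinAt) h0
  -- The quotient is controlled only on [a, b]; a continuous extension to the line makes its
  -- integral differentiable at the end points too.
  set f : ℝ → ℂ := IccExtend hab ((Icc a b).domRestrict fun τ => c' τ / c τ) with hf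
  have hfc : Continuous f := hcont.domRestrict.Icc_extend'
  have hfe : ∀ τ ∈ Icc a b, f τ = c' τ / c τ := fun τ hτ => by
    rw [hf, IccExtend_of_mem hab _ hτ, domRestrict_apply]
  have hint : ∫ τ in a..b, c' τ / c τ = ∫ τ in a..b, f τ :=
    integral_congr fun τ hτ => (hfe τ (by rwa [uIcc_of_le hab] at hτ)).symm
  have hF : ∀ τ, HasDerivAt (fun s => ∫ r in a..s, f r) (f τ) τ := fun τ =>
    (hfc.integral_hasStrictDerivAt a τ).hasDerivAt
  set g : ℝ → ℂ := fun τ => Complex.exp (-∫ r in a..τ, f r) * c τ with hg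
  have hgd : ∀ τ ∈ Icc a b, HasDerivAt g 0 τ := fun τ hτ => by
    have := ((hF τ).neg.cexp).mul (hc τ hτ)
    refine this.congr_deriv ?_
    rw [hfe τ hτ]
    have := h0 τ hτ
    simp only [Pi.neg_apply]
    field_simp
    ring
  have hconst := constant_of_has_deriv_right_zero (f := g)
    (fun τ hτ => (hgd τ hτ).continuousAt.continuousWithinAt)
    (fun τ hτ => (hgd τ (Ico_subset_Icc_self hτ)).hasDerivWithinAt) b (right_mem_Icc.2 hab)
  simp only [hg, integral_same, neg_zero, Complex.exp_zero, one_mul] at hconst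
  rw [hint, ← hconst, Complex.exp_neg]
  have hb := h0 b (right_mem_Icc.2 hab)
  have he := Complex.exp_ne_zero (∫ r in a..b, f r)
  field_simp

namespace IsAnalyticLoop

variable {z : ℝ → ℂ}

lemma continuousOn_logDeriv_dslope (hz : IsAnalyticLoop z) (t : ℝ) :
    ContinuousOn (fun τ => deriv (dslope z t) τ / dslope z t τ) (Icc (t - π) (t + π)) := by
  intro τ hτ
  have h : |τ - t| < 2 * π := by
    rw [abs_lt]; constructor <;> linarith [hτ.1, hτ.2, pi_pos]
  exact (((hz.analyticAt_dslope t τ).deriv.div (hz.analyticAt_dslope t τ)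
    (hz.dslope_ne_zero h)).continuousAt).continuousWithinAt

lemma integral_angleKernel_mul (hz : IsAnalyticLoop z) (t : ℝ) (f : ℝ → ℝ) :
    ∫ τ in (t - π)..(t + π), angleKernel z t τ * f τ =
      ∫ τ in (t - π)..(t + π), (deriv (dslope z t) τ / dslope z t τ).im * f τ := by
  rw [integral_of_le (by linarith [pi_pos]), integral_of_le (by linarith [pi_pos])]
  refine integral_congr_ae ?_
  filter_upwards [ae_restrict_ne t, ae_restrict_mem measurableSet_Ioc] with τ h1 h2
  have h : |τ - t| < 2 * π := by
    rw [abs_lt]; constructor <;> linarith [h2.1, h2.2, pi_pos]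
  rw [hz.angleKernel_eq h1 h]

lemma totalAngle_eq (hz : IsAnalyticLoop z) (t : ℝ) : totalAngle z t =
    ∫ τ in (t - π)..(t + π), (deriv (dslope z t) τ / dslope z t τ).im := by
  have h := hz.integral_angleKernel_mul t (fun _ => 1)
  simp only [mul_one] at h
  rw [← h, totalAngle, integral_comp_add_left (fun τ => angleKernel z t τ) t, sub_eq_add_neg]

/-- The points z(t + π) and z(t - π) coincide, but the divided difference divides by π and by -π, so
its end values have ratio -1. Since this ratio has modulus one, the integral of the logarithmic
derivative is purely imaginary. -/
lemma exp_totalAngle (hz : IsAnalyticLoop z) (t : ℝ) : Complex.exp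
    (totalAngle z t * Complex.I) = -1 := by
  have hlt : ∀ τ ∈ Icc (t - π) (t + π), |τ - t| < 2 * π := fun τ hτ => by
    rw [abs_lt]; constructor <;> linarith [hτ.1, hτ.2, pi_pos]
  have hle : t - π ≤ t + π := by linarith [pi_pos]
  have hexp := exp_integral_logDeriv hle
    (c := dslope z t) (c' := deriv (dslope z t))
    (fun τ _ => (hz.analyticAt_dslope t τ).differentiableAt.hasDerivAt)
    (fun τ _ => (hz.analyticAt_dslope t τ).deriv.continuousAt.continuousWithinAt)
    (fun τ hτ => hz.dslope_ne_zero (hlt τ hτ))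
  have hratio : dslope z t (t + π) / dslope z t (t - π) = -1 := by
    have h1 := sub_eq_mul_dslope z t (t + π)
    have h2 := sub_eq_mul_dslope z t (t - π)
    have h3 : z (t + π) = z (t - π) := by
      rw [← hz.periodic (t - π)]; congr 1; ring
    rw [h3, h2] at h1
    have h4 := hz.dslope_ne_zero (hlt (t - π) (left_mem_Icc.2 hle))
    rw [div_eq_iff h4]
    have hpi : (π : ℂ) ≠ 0 := by exact_mod_cast pi_ne_zero
    have : (π : ℂ) * (dslope z t (t + π) + dslope z t (t - π)) = 0 := by
      push_cast at h1
      linear_combination -h1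
    rcases mul_eq_zero.1 this with h | h
    · exact absurd h hpi
    · linear_combination h
  rw [hratio] at hexp
  have hii : IntervalIntegrable (fun τ => deriv (dslope z t) τ / dslope z t τ) volume
      (t - π) (t + π) := by
    refine ContinuousOn.intervalIntegrable ?_
    rw [uIcc_of_le hle]
    exact hz.continuousOn_logDeriv_dslope t
  set A := ∫ τ in (t - π)..(t + π), deriv (dslope z t) τ / dslope z t τ with hA
  have him : A.im = totalAngle z t := by
    rw [hz.totalAngle_eq, hA]
    exact (Complex.imCLM.intervalIntegral_comp_comm hii).symm
  have hre : A.re = 0 := by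
    have := congrArg norm hexp
    rw [Complex.norm_exp, norm_neg, norm_one] at this
    exact Real.exp_eq_one_iff _ |>.1 this
  rw [← hexp, ← him]
  congr 1
  apply Complex.ext <;> simp [hre]

end IsAnalyticLoop

/-! ### Independence of the base point -/

lemma eq_of_continuousOn_of_forall_int {α : Type*} [TopologicalSpace α] {s : Set α}
    (hs : IsPreconnected s) {f : α → ℝ} (hf : ContinuousOn f s)
    (hint : ∀ a ∈ s, ∃ n : ℤ, f a = n) {a b : α} (ha : a ∈ s) (hb : b ∈ s) : f a = f b := by
  have hd : IsDiscrete (range ((↑) : ℤ → ℝ)) := by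
    rw [← image_univ]
    exact (isDiscrete_univ_iff.2 inferInstance).image Int.isClosedEmbedding_coe_real.isInducing
  exact hs.constant_of_mapsTo hd hf (T := range ((↑) : ℤ → ℝ))
    (fun a ha => (hint a ha).imp fun n hn => hn.symm) ha hb

/-- The average of `z'` over the parameter interval from `t` to `t + u`. -/
def chordMean (z : ℝ → ℂ) (t u : ℝ) : ℂ := ∫ s in (0 : ℝ)..1, deriv z (t + s * u)

/-- The derivative of `chordMean z t u` with respect to `u`. -/
def chordMeanDeriv (z : ℝ → ℂ) (t u : ℝ) : ℂ :=
  ∫ s in (0 : ℝ)..1, s * deriv (deriv z) (t + s * u)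

namespace IsAnalyticLoop

variable {z : ℝ → ℂ}

lemma continuous_deriv_deriv (hz : IsAnalyticLoop z) : Continuous (deriv (deriv z)) :=
  continuous_iff_continuousAt.2 fun τ => (hz.analyticAt_deriv τ).deriv.continuousAt

lemma mul_chordMean (hz : IsAnalyticLoop z) (t u : ℝ) : u * chordMean z t u = z (t + u) - z t := by
  have hd : ∀ s ∈ uIcc (0 : ℝ) 1,
      HasDerivAt (fun s : ℝ => z (t + s * u)) (u * deriv z (t + s * u)) s := fun s _ => by
    have h1 : HasDerivAt (fun s : ℝ => t + s * u) u s := by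
      simpa using ((hasDerivAt_id s).mul_const u).const_add t
    exact ((hz.differentiable (t + s * u)).hasDerivAt.scomp s h1).congr_deriv (by simp)
  have hc := hz.continuous_deriv
  have := integral_eq_sub_of_hasDerivAt hd
    (Continuous.intervalIntegrable (by fun_prop) _ _)
  rw [intervalIntegral.integral_const_mul] at this
  simpa [chordMean] using this

lemma deriv_eq_chordMean (hz : IsAnalyticLoop z) (t u : ℝ) :
    deriv z (t + u) = chordMean z t u + u * chordMeanDeriv z t u := by
  have hc := hz.continuous_deriv
  have hc2 := hz.continuous_deriv_deriv
  have hd : ∀ s ∈ uIcc (0 : ℝ) 1, HasDerivAt (fun s : ℝ => (s : ℂ) * deriv z (t + s * u))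
      (deriv z (t + s * u) + u * (s * deriv (deriv z) (t + s * u))) s := fun s _ => by
    have h1 : HasDerivAt (fun s : ℝ => t + s * u) u s := by
      simpa using ((hasDerivAt_id s).mul_const u).const_add t
    have h2 : HasDerivAt (fun s : ℝ => deriv z (t + s * u))
        (u * deriv (deriv z) (t + s * u)) s := by
      have h3 := (hz.analyticAt_deriv (t + s * u)).differentiableAt.hasDerivAt.scomp s h1
      rwa [Complex.real_smul] at h3
    refine ((Complex.ofRealCLM.hasDerivAt (x := s)).mul h2).congr_deriv ?_
    simp; ring
  have := integral_eq_sub_of_hasDerivAt hd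
    (Continuous.intervalIntegrable (by fun_prop) _ _)
  rw [intervalIntegral.integral_add (Continuous.intervalIntegrable (by fun_prop) _ _)
    (Continuous.intervalIntegrable (by fun_prop) _ _), intervalIntegral.integral_const_mul] at this
  simpa [chordMean, chordMeanDeriv] using this.symm

lemma chordMean_ne_zero (hz : IsAnalyticLoop z) {t u : ℝ} (hu : |u| ≤ π) : chordMean z t u ≠ 0 := by
  rcases eq_or_ne u 0 with rfl | hne
  · simpa [chordMean] using hz.regular t
  · intro h0
    have h1 := hz.mul_chordMean t u
    rw [h0, mul_zero, eq_comm, sub_eq_zero, hz.eq_iff] at h1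
    have h2 := h1.eq_of_abs_lt (by rw [add_sub_cancel_left]; linarith [pi_pos])
    exact hne (by linarith)

lemma angleKernel_eq_chordMean (hz : IsAnalyticLoop z) {t u : ℝ} (hne : u ≠ 0) (hu : |u| ≤ π) :
    angleKernel z t (t + u) = (chordMeanDeriv z t u / chordMean z t u).im := by
  have h0 := hz.chordMean_ne_zero (t := t) hu
  have h2 : (u : ℂ) ≠ 0 := by exact_mod_cast hne
  have : deriv z (t + u) / (z (t + u) - z t) =
      ((u⁻¹ : ℝ) : ℂ) + chordMeanDeriv z t u / chordMean z t u := by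
    rw [← hz.mul_chordMean, hz.deriv_eq_chordMean]
    push_cast
    field_simp
  rw [angleKernel, this, Complex.add_im, Complex.ofReal_im, zero_add]

lemma continuous_chordMean
    (hz : IsAnalyticLoop z) : Continuous fun p : ℝ × ℝ => chordMean z p.1 p.2 := by
  have hc := hz.continuous_deriv
  exact continuous_parametric_intervalIntegral_of_continuous'
    (f := fun (p : ℝ × ℝ) s => deriv z (p.1 + s * p.2)) (by fun_prop) 0 1

lemma continuous_chordMeanDeriv
    (hz : IsAnalyticLoop z) : Continuous fun p : ℝ × ℝ => chordMeanDeriv z p.1 p.2 := by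
  have hc := hz.continuous_deriv_deriv
  exact continuous_parametric_intervalIntegral_of_continuous'
    (f := fun (p : ℝ × ℝ) s => (s : ℂ) * deriv (deriv z) (p.1 + s * p.2)) (by fun_prop) 0 1

/-- Writing divided differences as integrals over [0, 1] makes them jointly continuous in the base
point and the increment. -/
lemma continuous_totalAngle (hz : IsAnalyticLoop z) : Continuous (totalAngle z) := by
  have hle : -π ≤ π := by linarith [pi_pos]
  -- Clamping u to [-π, π] keeps the denominator nonzero for all u, as the continuity theorem needs
  -- a globally continuous integrand.
  let cl : ℝ → ℝ := fun u => projIcc (-π) π hle u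
  have hcl : Continuous cl := continuous_subtype_val.comp continuous_projIcc
  have hclm : ∀ u, |cl u| ≤ π := fun u => abs_le.2 (projIcc (-π) π hle u).2
  have heq : totalAngle z = fun t =>
      ∫ u in (-π)..π, (chordMeanDeriv z t (cl u) / chordMean z t (cl u)).im := by
    ext t
    rw [totalAngle, integral_of_le hle, integral_of_le hle]
    refine integral_congr_ae ?_
    filter_upwards [ae_restrict_ne 0, ae_restrict_mem measurableSet_Ioc] with u h1 h2
    have h3 : u ∈ Icc (-π) π := Ioc_subset_Icc_self h2
    have h4 : cl u = u := by simp only [cl, projIcc_of_mem hle h3]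
    rw [hz.angleKernel_eq_chordMean h1 (abs_le.2 h3), h4]
  rw [heq]
  refine continuous_parametric_intervalIntegral_of_continuous' ?_ _ _
  have hpair : Continuous fun p : ℝ × ℝ => (p.1, cl p.2) :=
    continuous_fst.prodMk (hcl.comp continuous_snd)
  exact Complex.continuous_im.comp ((hz.continuous_chordMeanDeriv.comp hpair).div
    (hz.continuous_chordMean.comp hpair) fun p => hz.chordMean_ne_zero (hclm p.2))

lemma exists_totalAngle_eq (hz : IsAnalyticLoop z) (t : ℝ) : ∃ n : ℤ, totalAngle z t = π + n *
    (2 * π) := by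
  have h := hz.exp_totalAngle t
  rw [← Complex.exp_pi_mul_I, Complex.exp_eq_exp_iff_exists_int] at h
  obtain ⟨n, hn⟩ := h
  refine ⟨n, ?_⟩
  have := congrArg Complex.im hn
  simpa using this

/-- Needed because the comparisons with an enclosed point and with a far point take place at
different base points. -/
lemma totalAngle_const (hz : IsAnalyticLoop z) (s t : ℝ) : totalAngle z s = totalAngle z t := by
  have h := eq_of_continuousOn_of_forall_int (s := univ) isPreconnected_univ
    (f := fun t => (totalAngle z t - π) / (2 * π))
    ((hz.continuous_totalAngle.sub continuous_const).div_const _).continuousOn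
    (fun a _ => (hz.exists_totalAngle_eq a).imp fun n hn => by
      rw [hn]; field_simp; ring) (mem_univ s) (mem_univ t)
  have h2 := two_pi_pos.ne'
  field_simp at h
  linarith

end IsAnalyticLoop

/-! ### Winding angles about points off the loop -/

/-- Total angle under which the loop `z` is seen from `q`: `2π` times the winding number. -/
def windingAngle (z : ℝ → ℂ) (q : ℂ) : ℝ := ∫ τ in (0 : ℝ)..(2 * π), (deriv z τ / (z τ - q)).im

lemma integral_symm_eq_of_periodic {E : Type*} [NormedAddCommGroup E] [NormedSpace ℝ E]
    {f : ℝ → E} (hf : Function.Periodic f (2 * π)) (t : ℝ) :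
    ∫ τ in (t - π)..(t + π), f τ = ∫ τ in (0 : ℝ)..(2 * π), f τ := by
  have := hf.intervalIntegral_add_eq (t - π) 0
  rwa [zero_add, show t - π + 2 * π = t + π by ring] at this

lemma ofReal_sub_mul_I_ne_zero (u : ℝ) {s : ℝ} (hs : s ≠ 0) : (u : ℂ) - s * Complex.I ≠ 0 :=
  fun h => by
    have := congrArg Complex.im h
    simp at this
    exact hs this

/-- The segment [-π, π] is seen from s i under the signed angle 2 arctan(π/s). -/
lemma abs_integral_im_inv_lt (s : ℝ) (hs : s ≠ 0) :
    |∫ u in (-π)..π, (((u : ℂ) - s * Complex.I)⁻¹).im| < π := by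
  have hd : ∀ u ∈ uIcc (-π) π, HasDerivAt (fun u : ℝ => arctan (u / s))
      ((((u : ℂ) - s * Complex.I)⁻¹).im) u := fun u _ => by
    have h1 := ((hasDerivAt_id u).div_const s).arctan
    refine h1.congr_deriv ?_
    have h2 : s ^ 2 + u ^ 2 ≠ 0 := by positivity
    have h3 : u * u + s * s ≠ 0 :=
      (add_pos_of_nonneg_of_pos (mul_self_nonneg u) (mul_self_pos.2 hs)).ne'
    simp [Complex.inv_im, Complex.normSq_apply]
    field_simp
    ring
  rw [integral_eq_sub_of_hasDerivAt hd (Continuous.intervalIntegrable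
    (Complex.continuous_im.comp (Continuous.inv₀ (by fun_prop)
      fun u => ofReal_sub_mul_I_ne_zero u hs)) _ _), abs_lt]
  constructor <;> linarith [arctan_lt_pi_div_two (π / s), neg_pi_div_two_lt_arctan (π / s),
    arctan_lt_pi_div_two (-π / s), neg_pi_div_two_lt_arctan (-π / s)]

namespace IsAnalyticLoop

variable {z : ℝ → ℂ}

lemma exists_windingAngle_eq (hz : IsAnalyticLoop z) {q : ℂ} (hq : q ∉ range z) :
    ∃ n : ℤ, windingAngle z q = n * (2 * π) := by
  have h0 : ∀ τ, z τ - q ≠ 0 := fun τ h => hq ⟨τ, sub_eq_zero.1 h⟩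
  have hexp := exp_integral_logDeriv (c := fun τ => z τ - q) (c' := deriv z) two_pi_pos.le
    (fun τ _ => (hz.differentiable τ).hasDerivAt.sub_const q) hz.continuous_deriv.continuousOn
    (fun τ _ => h0 τ)
  have hper : z (2 * π) = z 0 := by simpa using hz.periodic 0
  rw [hper, div_self (h0 0), Complex.exp_eq_one_iff] at hexp
  obtain ⟨n, hn⟩ := hexp
  refine ⟨n, ?_⟩
  have hii : IntervalIntegrable (fun τ => deriv z τ / (z τ - q)) volume 0 (2 * π) :=
    Continuous.intervalIntegrable
      (hz.continuous_deriv.div (hz.continuous.sub continuous_const) h0) _ _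
  have h1 := Complex.imCLM.intervalIntegral_comp_comm hii
  rw [hn] at h1
  simpa [windingAngle] using h1

lemma continuousOn_windingAngle (hz : IsAnalyticLoop z) : ContinuousOn (windingAngle z)
    (range z)ᶜ := by
  rw [continuousOn_iff_continuous_domRestrict]
  refine continuous_parametric_intervalIntegral_of_continuous'
    (f := fun (q : ((range z)ᶜ : Set ℂ)) τ => (deriv z τ / (z τ - q)).im) ?_ _ _
  refine Complex.continuous_im.comp ((hz.continuous_deriv.comp continuous_snd).div
    ((hz.continuous.comp continuous_snd).sub (continuous_subtype_val.comp continuous_fst)) ?_)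
  rintro ⟨⟨q, hq⟩, τ⟩ h
  exact hq ⟨τ, sub_eq_zero.1 h⟩

lemma windingAngle_eq_of_isPreconnected (hz : IsAnalyticLoop z) {s : Set ℂ} (hs : IsPreconnected s)
    (hsz : s ⊆ (range z)ᶜ) {p q : ℂ} (hp : p ∈ s) (hq : q ∈ s) :
    windingAngle z p = windingAngle z q := by
  have h := eq_of_continuousOn_of_forall_int hs
    (f := fun q => windingAngle z q / (2 * π))
    ((hz.continuousOn_windingAngle.mono hsz).div_const _)
    (fun a ha => (hz.exists_windingAngle_eq (hsz ha)).imp fun n hn => by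
      rw [hn]; field_simp) hp hq
  have h2 := two_pi_pos.ne'
  field_simp at h
  exact h

lemma isCompact_range (hz : IsAnalyticLoop z) : IsCompact (range z) :=
  hz.periodic.compact_of_continuous two_pi_pos.ne' hz.continuous

lemma exists_windingAngle_eq_zero
    (hz : IsAnalyticLoop z) : ∃ q ∉ range z, windingAngle z q = 0 := by
  obtain ⟨B, hB⟩ := hz.isCompact_range.isBounded.exists_norm_le
  obtain ⟨D, hD⟩ := (hz.periodic_deriv.compact_of_continuous two_pi_pos.ne'
    hz.continuous_deriv).isBounded.exists_norm_le
  have hB' : ∀ τ, ‖z τ‖ ≤ B := fun τ => hB _ ⟨τ, rfl⟩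
  have hD' : ∀ τ, ‖deriv z τ‖ ≤ D := fun τ => hD _ ⟨τ, rfl⟩
  have hB0 : 0 ≤ B := (norm_nonneg _).trans (hB' 0)
  have hD0 : 0 ≤ D := (norm_nonneg _).trans (hD' 0)
  -- At this distance the integrand is at most D/(D + 1) < 1, so the winding angle, a multiple of
  -- 2π, is smaller than 2π in modulus.
  set q : ℂ := ((B + D + 1 : ℝ) : ℂ) with hq
  have hqn : ‖q‖ = B + D + 1 := by
    rw [hq, Complex.norm_real, Real.norm_of_nonneg (by positivity)]
  have hdist : ∀ τ, D + 1 ≤ ‖z τ - q‖ := fun τ => by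
    have := norm_sub_norm_le q (z τ)
    rw [norm_sub_rev] at this
    linarith [hB' τ]
  have hqr : q ∉ range z := by
    rintro ⟨τ, hτ⟩
    have := hdist τ
    rw [hτ, sub_self, norm_zero] at this
    linarith
  refine ⟨q, hqr, ?_⟩
  obtain ⟨n, hn⟩ := hz.exists_windingAngle_eq hqr
  have hle : ‖windingAngle z q‖ ≤ D / (D + 1) * |2 * π - 0| := by
    refine norm_integral_le_of_norm_le_const fun τ _ => ?_
    refine (Complex.abs_im_le_norm _).trans ?_
    rw [norm_div]
    exact div_le_div₀ hD0 (hD' τ) (by positivity) (hdist τ)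
  rw [sub_zero, abs_of_pos two_pi_pos, hn, Real.norm_eq_abs, abs_mul, abs_of_pos two_pi_pos] at hle
  have h1 := le_of_mul_le_mul_right hle two_pi_pos
  have h2 : D / (D + 1) < 1 := by rw [div_lt_one (by positivity)]; linarith
  have h3 : |(n : ℝ)| < 1 := h1.trans_lt h2
  have : n = 0 := by
    rw [← Int.cast_abs] at h3
    exact Int.abs_lt_one_iff.1 (by exact_mod_cast h3)
  simp [hn, this]

/-- A point off the loop lies on the normal at one of its nearest points. -/
lemma exists_nearest (hz : IsAnalyticLoop z) {p : ℂ} (hp : p ∉ range z) : ∃ t r : ℝ, r ≠ 0 ∧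
    p = z t + r * (Complex.I * deriv z t) ∧ ∀ τ, ‖z t - p‖ ≤ ‖z τ - p‖ := by
  obtain ⟨_, ⟨t, rfl⟩, ht⟩ := hz.isCompact_range.exists_isMinOn (range_nonempty z)
    (f := fun w => ‖w - p‖) (by fun_prop)
  have hmin : ∀ τ, ‖z t - p‖ ≤ ‖z τ - p‖ := fun τ => ht (mem_range_self τ)
  have hd : HasDerivAt (fun τ => ‖z τ - p‖ ^ 2) _ t :=
    ((hz.differentiable t).hasDerivAt.sub_const p).norm_sq
  have hloc : IsLocalMin (fun τ => ‖z τ - p‖ ^ 2) t := Eventually.of_forall fun τ => by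
    have := hmin τ
    simp only
    gcongr
  have h0 := hloc.hasDerivAt_eq_zero hd
  have hT := hz.regular t
  -- The first-order condition says that p - z t is orthogonal to the tangent.
  have hre : ((p - z t) / deriv z t).re = 0 := by
    rw [Complex.inner] at h0
    simp only [Complex.mul_re, Complex.conj_re, Complex.conj_im, Complex.sub_re,
      Complex.sub_im] at h0
    rw [Complex.div_re, ← add_div, Complex.sub_re, Complex.sub_im]
    rw [div_eq_zero_iff]; left
    linarith
  refine ⟨t, ((p - z t) / deriv z t).im, ?_, ?_, hmin⟩
  · intro him
    have : (p - z t) / deriv z t = 0 := Complex.ext hre him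
    rw [div_eq_zero_iff] at this
    rcases this with h | h
    · exact hp ⟨t, (sub_eq_zero.1 h).symm⟩
    · exact hT h
  · have : (p - z t) / deriv z t = ((p - z t) / deriv z t).im * Complex.I := by
      apply Complex.ext <;> simp [hre]
    rw [div_eq_iff hT] at this
    linear_combination this

/-- The segment from p towards z t, without its end z t, consists of points nearer to p than the
loop is, so it avoids the loop. -/
lemma windingAngle_eq_near (hz : IsAnalyticLoop z) {p : ℂ} {t r θ : ℝ} (hr : r ≠ 0)
    (hpr : p = z t + r * (Complex.I * deriv z t)) (hmin : ∀ τ, ‖z t - p‖ ≤ ‖z τ - p‖)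
    (hθ : θ ∈ Ioc (0 : ℝ) 1) :
    z t + (θ * r : ℝ) * (Complex.I * deriv z t) ∉ range z ∧
    windingAngle z p = windingAngle z (z t + (θ * r : ℝ) * (Complex.I * deriv z t)) := by
  set f : ℝ → ℂ := fun θ => z t + (θ * r : ℝ) * (Complex.I * deriv z t) with hf
  have hfc : Continuous f := by fun_prop
  have hoff : f '' Ioc 0 1 ⊆ (range z)ᶜ := by
    rintro _ ⟨θ, hθ, rfl⟩ ⟨τ, hτ⟩
    have h1 := hmin τ
    rw [hτ] at h1
    have e1 : f θ - p = ((θ - 1) * r : ℝ) * (Complex.I * deriv z t) := by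
      rw [hpr, hf]; push_cast; ring
    have e2 : z t - p = (-r : ℝ) * (Complex.I * deriv z t) := by
      rw [hpr]; push_cast; ring
    have hpos : 0 < ‖Complex.I * deriv z t‖ :=
      norm_pos_iff.2 (mul_ne_zero Complex.I_ne_zero (hz.regular t))
    rw [e1, e2, norm_mul _ (_ * _), norm_mul _ (_ * _), Complex.norm_real, Complex.norm_real] at h1
    have h2 := le_of_mul_le_mul_right h1 hpos
    rw [Real.norm_eq_abs, Real.norm_eq_abs, abs_neg, abs_mul,
      abs_of_nonpos (a := θ - 1) (by linarith [hθ.2])] at h2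
    nlinarith [abs_pos.2 hr, hθ.1]
  have hpre : IsPreconnected (f '' Ioc 0 1) := isPreconnected_Ioc.image f hfc.continuousOn
  have h1 : p = f 1 := by rw [hf, hpr]; simp
  refine ⟨hoff (mem_image_of_mem f hθ), ?_⟩
  rw [h1]
  exact hz.windingAngle_eq_of_isPreconnected hpre hoff (mem_image_of_mem f ⟨one_pos, le_rfl⟩)
    (mem_image_of_mem f hθ)

end IsAnalyticLoop

/-! ### The jump of the angle along a normal -/

/-- Deviation of the angular densities seen from `z t` and from `z t + s i z'(t)` from the one of a
straight line. -/
def angleDefect (z : ℝ → ℂ) (t s u : ℝ) : ℂ :=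
  s * Complex.I * ((deriv z t - chordMean z t u) +
      deriv z t * (chordMeanDeriv z t u / chordMean z t u) * (u - s * Complex.I)) /
    ((u * chordMean z t u - s * Complex.I * deriv z t) * (u - s * Complex.I))

lemma abs_le_norm_sub_mul_I (u s : ℝ) : |s| ≤ ‖(u : ℂ) - s * Complex.I‖ := by
  simpa using Complex.abs_im_le_norm ((u : ℂ) - s * Complex.I)

lemma abs_le_norm_sub_mul_I' (u s : ℝ) : |u| ≤ ‖(u : ℂ) - s * Complex.I‖ := by
  simpa using Complex.abs_re_le_norm ((u : ℂ) - s * Complex.I)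

namespace IsAnalyticLoop

variable {z : ℝ → ℂ}

/-- An exact decomposition: density seen from z t, density of a straight line, and an error carrying
a factor s. -/
lemma deriv_div_sub_normal (hz : IsAnalyticLoop z) {t s u : ℝ} (hs : s ≠ 0) (hu : |u| ≤ π)
    (hq : z (t + u) - (z t + s * (Complex.I * deriv z t)) ≠ 0) :
    deriv z (t + u) / (z (t + u) - (z t + s * (Complex.I * deriv z t))) =
      chordMeanDeriv z t u / chordMean z t u + ((u : ℂ) - s * Complex.I)⁻¹ +
        angleDefect z t s u := by
  have h0 := hz.chordMean_ne_zero (t := t) hu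
  have h1 := ofReal_sub_mul_I_ne_zero u hs
  have h2 : z (t + u) - (z t + s * (Complex.I * deriv z t)) =
      u * chordMean z t u - s * Complex.I * deriv z t := by
    rw [hz.mul_chordMean]; ring
  rw [h2] at hq ⊢
  rw [hz.deriv_eq_chordMean, angleDefect]
  generalize hD : (u : ℂ) * chordMean z t u - s * Complex.I * deriv z t = D at hq
  field_simp
  rw [← hD]
  ring

lemma continuous_chordMean_right (hz : IsAnalyticLoop z) (t : ℝ) : Continuous (chordMean z t) :=
  hz.continuous_chordMean.comp (Continuous.prodMk continuous_const continuous_id)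

lemma continuous_chordMeanDeriv_right (hz : IsAnalyticLoop z) (t : ℝ) : Continuous
    (chordMeanDeriv z t) :=
  hz.continuous_chordMeanDeriv.comp (Continuous.prodMk continuous_const continuous_id)

lemma chordMean_zero (t : ℝ) : chordMean z t 0 = deriv z t := by simp [chordMean]

lemma chordMean_eq_dslope (hz : IsAnalyticLoop z) (t u : ℝ) : chordMean z t u = dslope z t
    (t + u) := by
  rcases eq_or_ne u 0 with rfl | hne
  · rw [chordMean_zero, add_zero, dslope_same]
  · have h1 := hz.mul_chordMean t u
    rw [sub_eq_mul_dslope, add_sub_cancel_left] at h1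
    exact mul_left_cancel₀ (by exact_mod_cast hne) h1

lemma exists_norm_deriv_sub_chordMean_le (hz : IsAnalyticLoop z) (t : ℝ) :
    ∃ C : ℝ, ∀ u : ℝ, |u| ≤ π → ‖deriv z t - chordMean z t u‖ ≤ C * |u| := by
  have hcont : Continuous (dslope (dslope z t) t) := continuous_iff_continuousAt.2 fun τ =>
    (LayerPotential.analyticAt_dslope (hz.analyticAt_dslope t t)
      (hz.analyticAt_dslope t τ)).continuousAt
  obtain ⟨C, hC⟩ := (isCompact_Icc (a := t - π) (b := t + π)).exists_bound_of_continuousOn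
    hcont.continuousOn
  refine ⟨C, fun u hu => ?_⟩
  have h1 := sub_eq_mul_dslope (dslope z t) t (t + u)
  rw [dslope_same, ← hz.chordMean_eq_dslope, add_sub_cancel_left] at h1
  rw [norm_sub_rev, h1, norm_mul, Complex.norm_real, Real.norm_eq_abs, mul_comm]
  gcongr
  exact hC _ ⟨by linarith [(abs_le.1 hu).1], by linarith [(abs_le.1 hu).2]⟩

/-- For small u the curve is close to its tangent, for which the distance is |u - s i| |z'(t)|; for
larger u the chord is bounded below and s is small. -/
lemma exists_norm_normal_ge (hz : IsAnalyticLoop z)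
    (t : ℝ) : ∃ s₀ > 0, ∀ s u : ℝ, |s| ≤ s₀ → |u| ≤ π →
    |s| * (‖deriv z t‖ / 2) ≤ ‖u * chordMean z t u - s * Complex.I * deriv z t‖ := by
  have hT : 0 < ‖deriv z t‖ := norm_pos_iff.2 (hz.regular t)
  have hc := hz.continuous_chordMean_right t
  obtain ⟨δ, hδ, hδ'⟩ := Metric.continuousAt_iff.1 (hc.continuousAt (x := 0))
    (‖deriv z t‖ / 2) (half_pos hT)
  rw [chordMean_zero] at hδ'
  obtain ⟨m, hm, hm'⟩ : ∃ m > 0, ∀ u : ℝ, |u| ≤ π → m ≤ ‖chordMean z t u‖ := by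
    obtain ⟨u₀, hu₀, hmin⟩ := (isCompact_Icc (a := -π) (b := π)).exists_isMinOn
      ⟨0, by constructor <;> linarith [pi_pos]⟩ (f := fun u => ‖chordMean z t u‖)
      hc.norm.continuousOn
    exact ⟨_, norm_pos_iff.2 (hz.chordMean_ne_zero (abs_le.2 hu₀)),
      fun u hu => hmin (abs_le.1 hu)⟩
  -- This bound on |s| gives 2 |s| |z'(t)| ≤ δ m, so subtracting the normal shift from a chord of
  -- length at least δ m leaves |s| |z'(t)|.
  refine ⟨δ * m / (2 * ‖deriv z t‖), by positivity, fun s u hs hu => ?_⟩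
  rcases lt_or_ge |u| δ with h | h
  · have h1 : ‖chordMean z t u - deriv z t‖ < ‖deriv z t‖ / 2 := by
      rw [← dist_eq_norm]; exact hδ' (by rwa [Real.dist_eq, sub_zero])
    have h2 : u * chordMean z t u - s * Complex.I * deriv z t =
        (u - s * Complex.I) * deriv z t - u * (deriv z t - chordMean z t u) := by ring
    have h3 := norm_sub_norm_le ((u - s * Complex.I) * deriv z t)
      (u * (deriv z t - chordMean z t u))
    rw [← h2, norm_mul, norm_mul, Complex.norm_real, Real.norm_eq_abs, norm_sub_rev (deriv z t)]
      at h3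
    nlinarith [abs_le_norm_sub_mul_I u s, abs_le_norm_sub_mul_I' u s, abs_nonneg u,
      norm_nonneg (chordMean z t u - deriv z t)]
  · have h3 := norm_sub_norm_le (u * chordMean z t u) (s * Complex.I * deriv z t)
    rw [norm_mul, norm_mul, norm_mul, Complex.norm_real, Complex.norm_real, Complex.norm_I,
      mul_one, Real.norm_eq_abs, Real.norm_eq_abs] at h3
    have h4 : δ * m ≤ |u| * ‖chordMean z t u‖ :=
      mul_le_mul h (hm' u hu) hm.le (abs_nonneg u)
    rw [le_div_iff₀ (by positivity)] at hs
    linarith [mul_nonneg (abs_nonneg s) hT.le]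

/-- Both terms of the numerator are O(|u - s i|), the first because the chord mean differs from
z'(t) by O(|u|); this cancels one factor of the denominator. -/
lemma exists_norm_angleDefect_le (hz : IsAnalyticLoop z)
    (t : ℝ) : ∃ C : ℝ, 0 ≤ C ∧ ∀ s u : ℝ, s ≠ 0 → |u| ≤ π →
    ‖angleDefect z t s u‖ ≤ |s| * C / ‖u * chordMean z t u - s * Complex.I * deriv z t‖ := by
  obtain ⟨C₁, hC₁⟩ := hz.exists_norm_deriv_sub_chordMean_le t
  obtain ⟨C₂, hC₂⟩ := (isCompact_Icc (a := -π) (b := π)).exists_bound_of_continuousOn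
    (f := fun u => chordMeanDeriv z t u / chordMean z t u)
    ((hz.continuous_chordMeanDeriv_right t).continuousOn.div
      (hz.continuous_chordMean_right t).continuousOn
      fun u hu => hz.chordMean_ne_zero (abs_le.2 hu))
  have hC₂0 : 0 ≤ C₂ := (norm_nonneg _).trans
    (hC₂ 0 (by constructor <;> linarith [pi_pos]))
  have hC₁0 : 0 ≤ C₁ := by
    have := (norm_nonneg _).trans (hC₁ π (abs_of_pos pi_pos).le)
    exact nonneg_of_mul_nonneg_left this (abs_pos.2 pi_ne_zero)
  refine ⟨C₁ + ‖deriv z t‖ * C₂, by positivity, fun s u hs hu => ?_⟩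
  have h1 : 0 < ‖(u : ℂ) - s * Complex.I‖ := norm_pos_iff.2 (ofReal_sub_mul_I_ne_zero u hs)
  rw [angleDefect, norm_div, norm_mul, norm_mul, norm_mul, Complex.norm_real, Complex.norm_I,
    mul_one, Real.norm_eq_abs, mul_comm ‖_ * _ - _‖, ← div_div]
  gcongr
  rw [mul_div_assoc]
  gcongr
  rw [div_le_iff₀ h1, add_mul]
  refine (norm_add_le _ _).trans ?_
  rw [norm_mul, norm_mul]
  gcongr
  · exact (hC₁ u hu).trans (by gcongr; exact abs_le_norm_sub_mul_I' u s)
  · exact hC₂ u (abs_le.1 hu)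

/-- Dominated convergence: the lower bound on the distance cancels the factor |s| and gives a
constant majorant, while for fixed u ≠ 0 the denominator stays away from 0. -/
lemma tendsto_integral_angleDefect (hz : IsAnalyticLoop z) (t : ℝ) :
    Tendsto (fun s => ∫ u in (-π)..π, angleDefect z t s u) (𝓝[≠] 0) (𝓝 0) := by
  obtain ⟨s₀, hs₀, hge⟩ := hz.exists_norm_normal_ge t
  obtain ⟨C, hC, hle⟩ := hz.exists_norm_angleDefect_le t
  have hT : 0 < ‖deriv z t‖ := norm_pos_iff.2 (hz.regular t)
  have hA := hz.continuous_chordMean_right t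
  have hB := hz.continuous_chordMeanDeriv_right t
  have hmem : ∀ u ∈ uIoc (-π) π, |u| ≤ π := fun u hu => by
    rw [uIoc_of_le (by linarith [pi_pos])] at hu
    exact abs_le.2 ⟨hu.1.le, hu.2⟩
  have hzero : (0 : ℂ) = ∫ u in (-π)..π, (0 : ℂ) := by simp
  rw [hzero]
  refine tendsto_integral_filter_of_dominated_convergence (fun _ => 2 * C / ‖deriv z t‖)
    ?_ ?_ ?_ ?_
  · refine Eventually.of_forall fun s => Measurable.aestronglyMeasurable ?_
    have h1 : Continuous fun u : ℝ => (u : ℂ) - s * Complex.I := by fun_prop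
    have h2 : Continuous fun u : ℝ => (u : ℂ) := by fun_prop
    unfold angleDefect
    have := hA.measurable
    have := hB.measurable
    have := h1.measurable
    fun_prop
  · have h1 : ∀ᶠ s : ℝ in 𝓝[≠] 0, |s| < s₀ := by
      refine eventually_nhdsWithin_of_eventually_nhds ?_
      exact (continuous_abs.tendsto' 0 0 abs_zero).eventually (gt_mem_nhds hs₀)
    filter_upwards [h1, self_mem_nhdsWithin] with s hs hs0
    refine Eventually.of_forall fun u hu => (hle s u hs0 (hmem u hu)).trans ?_
    have h2 := hge s u hs.le (hmem u hu)
    have h3 : 0 < |s| := abs_pos.2 hs0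
    calc |s| * C / ‖u * chordMean z t u - s * Complex.I * deriv z t‖
        ≤ |s| * C / (|s| * (‖deriv z t‖ / 2)) := by gcongr
      _ = 2 * C / ‖deriv z t‖ := by field_simp
  · exact intervalIntegrable_const
  · filter_upwards [show ∀ᵐ u : ℝ, u ≠ 0 by simp [ae_iff]] with u hu0 hu
    have h0 : (u : ℂ) * chordMean z t u ≠ 0 :=
      mul_ne_zero (by exact_mod_cast hu0) (hz.chordMean_ne_zero (hmem u hu))
    have h1 : Tendsto (fun s : ℝ =>
        |s| * C / ‖u * chordMean z t u - s * Complex.I * deriv z t‖) (𝓝 0) (𝓝 0) := by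
      have : ContinuousAt (fun s : ℝ =>
          |s| * C / ‖u * chordMean z t u - s * Complex.I * deriv z t‖) 0 := by
        refine ContinuousAt.div (by fun_prop) (by fun_prop) ?_
        simpa using h0
      simpa [ContinuousAt] using this
    refine squeeze_zero_norm' ?_ (h1.mono_left nhdsWithin_le_nhds)
    filter_upwards [self_mem_nhdsWithin] with s hs0
    exact hle s u hs0 (hmem u hu)

lemma windingAngle_normal_sub (hz : IsAnalyticLoop z) {t s : ℝ} (hs : s ≠ 0)
    (hq : z t + s * (Complex.I * deriv z t) ∉ range z) :
    windingAngle z (z t + s * (Complex.I * deriv z t)) - totalAngle z t =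
      (∫ u in (-π)..π, (((u : ℂ) - s * Complex.I)⁻¹).im) +
        (∫ u in (-π)..π, angleDefect z t s u).im := by
  have hle : -π ≤ π := by linarith [pi_pos]
  set q := z t + s * (Complex.I * deriv z t) with hqdef
  have h0 : ∀ τ, z τ - q ≠ 0 := fun τ h => hq ⟨τ, sub_eq_zero.1 h⟩
  have hw : windingAngle z q = ∫ u in (-π)..π, (deriv z (t + u) / (z (t + u) - q)).im := by
    have hper : Function.Periodic (fun τ => (deriv z τ / (z τ - q)).im) (2 * π) := fun τ => by
      simp only [hz.periodic τ, hz.periodic_deriv τ]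
    rw [windingAngle, ← integral_symm_eq_of_periodic hper t,
      integral_comp_add_left (fun τ => (deriv z τ / (z τ - q)).im) t, sub_eq_add_neg]
  have hI : totalAngle z t =
      ∫ u in (-π)..π, (chordMeanDeriv z t u / chordMean z t u).im := by
    rw [totalAngle, integral_of_le hle, integral_of_le hle]
    refine integral_congr_ae ?_
    filter_upwards [ae_restrict_ne 0, ae_restrict_mem measurableSet_Ioc] with u h1 h2
    rw [hz.angleKernel_eq_chordMean h1 (abs_le.2 (Ioc_subset_Icc_self h2))]
  have hA := hz.continuous_chordMean_right t
  have hB := hz.continuous_chordMeanDeriv_right t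
  have i1 : IntervalIntegrable (fun u => deriv z (t + u) / (z (t + u) - q)) volume (-π) π := by
    have h1 := hz.continuous_deriv
    have h2 := hz.continuous
    exact Continuous.intervalIntegrable
      (Continuous.div (by fun_prop) (by fun_prop) fun u => h0 (t + u)) _ _
  have i2 : IntervalIntegrable (fun u => chordMeanDeriv z t u / chordMean z t u) volume (-π) π := by
    refine ContinuousOn.intervalIntegrable (hB.continuousOn.div hA.continuousOn fun u hu => ?_)
    rw [uIcc_of_le hle] at hu
    exact hz.chordMean_ne_zero (abs_le.2 hu)
  have i3 : IntervalIntegrable (fun u : ℝ => ((u : ℂ) - s * Complex.I)⁻¹) volume (-π) π :=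
    Continuous.intervalIntegrable
      (Continuous.inv₀ (by fun_prop) fun u => ofReal_sub_mul_I_ne_zero u hs) _ _
  have hdef : ∫ u in (-π)..π, angleDefect z t s u =
      ∫ u in (-π)..π, (deriv z (t + u) / (z (t + u) - q) -
        chordMeanDeriv z t u / chordMean z t u - ((u : ℂ) - s * Complex.I)⁻¹) := by
    refine integral_congr fun u hu => ?_
    rw [uIcc_of_le hle] at hu
    rw [hz.deriv_div_sub_normal hs (abs_le.2 hu) (h0 _)]
    ring
  have c1 := Complex.imCLM.intervalIntegral_comp_comm i1
  have c2 := Complex.imCLM.intervalIntegral_comp_comm i2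
  have c3 := Complex.imCLM.intervalIntegral_comp_comm i3
  simp only [Complex.imCLM_apply] at c1 c2 c3
  rw [hw, hI, hdef, intervalIntegral.integral_sub (i1.sub i2) i3,
    intervalIntegral.integral_sub i1 i2, Complex.sub_im, Complex.sub_im, c1, c2, c3]
  ring

/-- The π bounds the straight-line contribution; the 1 absorbs the defect at a small nonzero s, and
any slack up to 2π would serve. -/
lemma exists_abs_windingAngle_sub_lt (hz : IsAnalyticLoop z) {p : ℂ} (hp : p ∉ range z) :
    ∃ t, |windingAngle z p - totalAngle z t| < π + 1 := by
  obtain ⟨t, r, hr, hpr, hmin⟩ := hz.exists_nearest hp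
  refine ⟨t, ?_⟩
  have h1 := (hz.tendsto_integral_angleDefect t).norm.eventually
    (gt_mem_nhds (by rw [norm_zero]; exact one_pos))
  have h2 : Tendsto (fun θ : ℝ => θ * r) (𝓝[>] 0) (𝓝[≠] 0) := by
    refine tendsto_nhdsWithin_iff.2 ⟨?_, ?_⟩
    · exact ((continuous_mul_const r).tendsto' 0 0 (zero_mul r)).mono_left nhdsWithin_le_nhds
    · filter_upwards [self_mem_nhdsWithin] with θ hθ
      exact mul_ne_zero (ne_of_gt hθ) hr
  obtain ⟨θ, hθ1, hθ⟩ := ((h2.eventually h1).and (Ioc_mem_nhdsGT (zero_lt_one' ℝ))).exists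
  obtain ⟨hoff, heq⟩ := hz.windingAngle_eq_near hr hpr hmin hθ
  have hs : θ * r ≠ 0 := mul_ne_zero hθ.1.ne' hr
  rw [heq, hz.windingAngle_normal_sub hs hoff]
  refine (abs_add_le _ _).trans_lt (add_lt_add (abs_integral_im_inv_lt _ hs) ?_)
  exact (Complex.abs_im_le_norm _).trans_lt hθ1

/-- A counterclockwise simple loop is seen from each of its own points under the total
angle `π`. -/
theorem totalAngle_eq_pi (hz : IsAnalyticLoop z) {p : ℂ} (hp : p ∉ range z)
    (hw : windingAngle z p = 2 * π) (t : ℝ) :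
    totalAngle z t = π := by
  obtain ⟨q, hq, hq0⟩ := hz.exists_windingAngle_eq_zero
  obtain ⟨t₁, h₁⟩ := hz.exists_abs_windingAngle_sub_lt hp
  obtain ⟨t₂, h₂⟩ := hz.exists_abs_windingAngle_sub_lt hq
  rw [hz.totalAngle_const t₁ t, hw] at h₁
  rw [hz.totalAngle_const t₂ t, hq0] at h₂
  obtain ⟨n, hn⟩ := hz.exists_totalAngle_eq t
  rw [hn, abs_lt] at h₁ h₂
  have hpi := pi_gt_three
  -- Closeness to the winding angle 0 excludes n ≥ 1; closeness to 2π excludes n ≤ -1.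
  have hn1 : (n : ℝ) < 1 := by
    by_contra! h
    nlinarith
  have hn2 : (-1 : ℝ) < n := by
    by_contra! h
    nlinarith
  have : n = 0 := by
    have a : n < 1 := by exact_mod_cast hn1
    have b : -1 < n := by exact_mod_cast hn2
    omega
  rw [hn, this]
  simp

end IsAnalyticLoop

/-! ### Logarithmic singularities damped by powers -/

lemma analyticAt_iteratedDeriv {f : ℝ → ℝ} {t : ℝ} (hf : AnalyticAt ℝ f t) (n : ℕ) :
    AnalyticAt ℝ (iteratedDeriv n f) t := by
  rw [iteratedDeriv_eq_iterate]
  exact hf.iterated_deriv n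

lemma periodic_iteratedDeriv {f : ℝ → ℝ} {p : ℝ} (hf : Function.Periodic f p) (n : ℕ) :
    Function.Periodic (iteratedDeriv n f) p := fun τ => by
  have h : (fun s => f (s + p)) = f := funext hf
  have := congrFun (iteratedDeriv_comp_add_const n f p) τ
  rw [h] at this
  exact this.symm

lemma tendsto_log_sub_atBot (t : ℝ) : Tendsto (fun τ => log (τ - t)) (𝓝[≠] t) atBot := by
  refine tendsto_log_nhdsNE_zero.comp (tendsto_nhdsWithin_iff.2 ⟨?_, ?_⟩)
  · exact ((continuous_sub_right t).tendsto' t 0 (sub_self t)).mono_left nhdsWithin_le_nhds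
  · filter_upwards [self_mem_nhdsWithin] with τ hτ
    exact sub_ne_zero.2 hτ

lemma isBigO_log_of_continuousAt {f : ℝ → ℝ} {t : ℝ} (hf : ContinuousAt f t) :
    f =O[𝓝[≠] t] fun τ => log (τ - t) := by
  have h1 : f =O[𝓝[≠] t] fun _ => (1 : ℝ) :=
    (hf.tendsto.mono_left nhdsWithin_le_nhds).isBigO_one ℝ
  exact h1.trans ((isLittleO_const_left.2 (Or.inr
    (tendsto_abs_atBot_atTop.comp (tendsto_log_sub_atBot t)))).isBigO)

lemma isBigO_log_mul {f : ℝ → ℝ} {t : ℝ} (hf : ContinuousAt f t) :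
    (fun τ => log (τ - t) * f τ) =O[𝓝[≠] t] fun τ => log (τ - t) := by
  have h1 : f =O[𝓝[≠] t] fun _ => (1 : ℝ) :=
    (hf.tendsto.mono_left nhdsWithin_le_nhds).isBigO_one ℝ
  simpa using (isBigO_refl (fun τ => log (τ - t)) (𝓝[≠] t)).mul h1

lemma continuous_pow_succ_mul_log (n : ℕ) : Continuous fun u : ℝ => u ^ (n + 1) * log u := by
  have : (fun u : ℝ => u ^ (n + 1) * log u) = fun u => u ^ n * (u * log u) := by
    ext u; ring
  rw [this]
  exact (continuous_pow n).mul continuous_mul_log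

/-- The formula holds at u = 0 as well, since u^(n+1) log u tends to 0 and `log 0 = 0`. -/
lemma hasDerivAt_pow_mul_log (n : ℕ) (u : ℝ) :
    HasDerivAt (fun u : ℝ => u ^ (n + 2) * log u)
      ((n + 2) * (u ^ (n + 1) * log u) + u ^ (n + 1)) u := by
  rcases eq_or_ne u 0 with rfl | hu
  · rw [hasDerivAt_iff_tendsto_slope]
    have h1 := ((continuous_pow_succ_mul_log n).tendsto 0).mono_left
      (nhdsWithin_le_nhds (s := {(0 : ℝ)}ᶜ))
    simp only [log_zero, mul_zero, ne_eq, Nat.add_eq_zero_iff, one_ne_zero, and_false,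
      not_false_eq_true, zero_pow, add_zero] at h1 ⊢
    refine h1.congr' ?_
    filter_upwards [self_mem_nhdsWithin] with v hv
    have hv' : v ≠ 0 := hv
    simp only [slope_def_field, log_zero, mul_zero, sub_zero]
    field_simp
    ring
  · have h1 := (hasDerivAt_pow (n + 2) u).mul (hasDerivAt_log hu)
    refine h1.congr_deriv ?_
    push_cast
    field_simp
    ring

lemma contDiffAt_succ_of_deriv {f f' : ℝ → ℝ} {t : ℝ} {n : ℕ}
    (hd : ∀ᶠ τ in 𝓝 t, HasDerivAt f (f' τ) τ) (hcd : ContDiffAt ℝ n f' t) :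
    ContDiffAt ℝ (n + 1 : ℕ) f t := by
  push_cast
  refine contDiffAt_succ_iff_hasFDerivAt.2
    ⟨fun τ => ContinuousLinearMap.toSpanSingleton ℝ (f' τ), ⟨_, hd, fun τ hτ => hτ.hasFDerivAt⟩, ?_⟩
  exact (ContinuousLinearMap.toSpanSingletonCLE (𝕜 := ℝ) (E := ℝ)).contDiff.contDiffAt.comp t hcd

/-- Regularity of a logarithm damped by a power. -/
lemma pow_mul_log_regularity {t : ℝ} (n : ℕ) : ∀ {f g k : ℝ → ℝ}, AnalyticAt ℝ g t →
    AnalyticAt ℝ k t →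
    (f =ᶠ[𝓝 t] fun τ => (τ - t) ^ (n + 1) * log (τ - t) * g τ + k τ) →
    ContDiffAt ℝ n f t ∧ iteratedDeriv (n + 1) f =O[𝓝[≠] t] fun τ => log (τ - t) := by
  induction n with
  | zero =>
    intro f g k hg hk hf
    constructor
    · refine ContDiffAt.congr_of_eventuallyEq ?_ hf
      simp only [CharP.cast_eq_zero]
      have h := continuous_pow_succ_mul_log 0
      refine contDiffAt_zero.2 ⟨{τ | AnalyticAt ℝ g τ ∧ AnalyticAt ℝ k τ},
        hg.eventually_analyticAt.and hk.eventually_analyticAt, fun τ hτ => ?_⟩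
      exact ((((h.comp (continuous_sub_right t)).continuousAt).mul hτ.1.continuousAt).add
        hτ.2.continuousAt).continuousWithinAt
    · have hd : ∀ᶠ τ in 𝓝[≠] t, iteratedDeriv (0 + 1) f τ =
          log (τ - t) * (g τ + (τ - t) * deriv g τ) + (g τ + deriv k τ) := by
        have h1 : ∀ᶠ τ in 𝓝[≠] t, AnalyticAt ℝ g τ ∧ AnalyticAt ℝ k τ :=
          eventually_nhdsWithin_of_eventually_nhds
            (hg.eventually_analyticAt.and hk.eventually_analyticAt)
        filter_upwards [h1, eventually_nhdsWithin_of_eventually_nhds hf.eventually_nhds,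
          self_mem_nhdsWithin] with τ hτ hfτ hne
        have hne' : τ - t ≠ 0 := sub_ne_zero.2 hne
        rw [zero_add, iteratedDeriv_one, EventuallyEq.deriv_eq hfτ]
        have h2 := (((((hasDerivAt_id τ).sub_const t).pow (0 + 1)).mul
          (((hasDerivAt_id τ).sub_const t).log hne')).mul
          hτ.1.differentiableAt.hasDerivAt).add hτ.2.differentiableAt.hasDerivAt
        refine (HasDerivAt.congr_deriv h2 ?_).deriv
        simp
        field_simp
        ring
      refine IsBigO.congr' ?_ (hd.mono fun _ h => h.symm) EventuallyEq.rfl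
      refine (isBigO_log_mul ?_).add (isBigO_log_of_continuousAt ?_)
      · exact hg.continuousAt.add (((continuous_sub_right t).continuousAt).mul
          hg.deriv.continuousAt)
      · exact hg.continuousAt.add hk.deriv.continuousAt
  | succ n ih =>
    intro f g k hg hk hf
    have hid : AnalyticAt ℝ (fun τ : ℝ => τ - t) t := analyticAt_id.sub analyticAt_const
    -- Differentiation reproduces the shape with exponent lowered by one; the analytic summand k
    -- exists to absorb the terms without logarithm.
    have hd : ∀ᶠ τ in 𝓝 t, HasDerivAt f ((τ - t) ^ (n + 1) * log (τ - t) *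
        ((n + 2) * g τ + (τ - t) * deriv g τ) + ((τ - t) ^ (n + 1) * g τ + deriv k τ)) τ := by
      filter_upwards [hg.eventually_analyticAt, hk.eventually_analyticAt,
        hf.eventually_nhds] with τ hgτ hkτ hfτ
      refine HasDerivAt.congr_of_eventuallyEq ?_ hfτ
      have h1 := (hasDerivAt_pow_mul_log n (τ - t)).comp_sub_const τ t
      have h2 := (h1.mul hgτ.differentiableAt.hasDerivAt).add hkτ.differentiableAt.hasDerivAt
      refine h2.congr_deriv ?_
      ring
    have hderiv : deriv f =ᶠ[𝓝 t] fun τ => (τ - t) ^ (n + 1) * log (τ - t) *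
        ((n + 2) * g τ + (τ - t) * deriv g τ) + ((τ - t) ^ (n + 1) * g τ + deriv k τ) :=
      hd.mono fun τ hτ => hτ.deriv
    obtain ⟨h1, h2⟩ := ih
      ((analyticAt_const (v := (n + 2 : ℝ)).mul hg).add (hid.mul hg.deriv))
      (((hid.pow (n + 1)).mul hg).add hk.deriv) hderiv
    refine ⟨contDiffAt_succ_of_deriv (hd.mono fun τ hτ => hτ.differentiableAt.hasDerivAt) h1, ?_⟩
    rw [iteratedDeriv_succ']
    exact h2

lemma integrableAtFilter_log (t : ℝ) : IntegrableAtFilter (fun τ => log (τ - t)) (𝓝 t) := by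
  refine ⟨Icc (t - 1) (t + 1), Icc_mem_nhds (by linarith) (by linarith), ?_⟩
  rw [← intervalIntegrable_iff_integrableOn_Icc_of_le (by linarith)]
  have := (intervalIntegrable_log' (a := -1) (b := 1)).comp_sub_right t
  convert this using 1 <;> ring

/-- The bound controls only punctured neighbourhoods; the missing point is a null set and is put
back. -/
lemma locallyIntegrable_of_isBigO_log {f : ℝ → ℝ} (hm : Measurable f)
    (hf : ∀ t, f =O[𝓝[≠] t] fun τ => log (τ - t)) : LocallyIntegrable f := by
  intro t
  have := (measurableSet_singleton t).compl.nhdsWithin_isMeasurablyGenerated t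
  obtain ⟨s, hs, hint⟩ := (hf t).integrableAtFilter (μ := volume)
    hm.stronglyMeasurable.stronglyMeasurableAtFilter
    ((integrableAtFilter_log t).filter_mono nhdsWithin_le_nhds)
  refine ⟨insert t s, ?_, ?_⟩
  · exact insert_mem_nhds_iff.2 hs
  · rw [insert_eq]
    exact (integrableOn_singleton (hx := by simp)).union hint

lemma intervalIntegrable_of_locallyIntegrable {f : ℝ → ℝ} (hf : LocallyIntegrable f) (a b : ℝ) :
    IntervalIntegrable f volume a b := by
  rw [intervalIntegrable_iff']
  exact hf.integrableOn_isCompact isCompact_uIcc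

lemma norm_sq_eq_re_sq_add_im_sq (w : ℂ) : ‖w‖ ^ 2 = w.re ^ 2 + w.im ^ 2 := by
  rw [Complex.sq_norm, Complex.normSq_apply]; ring

lemma analyticAt_log_norm {f : ℝ → ℂ} {t : ℝ} (hf : AnalyticAt ℝ f t) (h0 : f t ≠ 0) :
    AnalyticAt ℝ (fun τ => log ‖f τ‖) t := by
  have h1 : (fun τ => log ‖f τ‖) = fun τ => log ((f τ).re ^ 2 + (f τ).im ^ 2) / 2 := by
    ext τ
    rw [← norm_sq_eq_re_sq_add_im_sq, log_pow]
    push_cast; ring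
  rw [h1]
  have hre : AnalyticAt ℝ (fun τ => (f τ).re) t := (Complex.reCLM.analyticAt _).comp hf
  have him : AnalyticAt ℝ (fun τ => (f τ).im) t := (Complex.imCLM.analyticAt _).comp hf
  refine (((hre.pow 2).add (him.pow 2)).log ?_).div_const
  simp only [Pi.add_apply, Pi.pow_apply]
  rw [← norm_sq_eq_re_sq_add_im_sq]
  have := norm_pos_iff.2 h0
  positivity

namespace IsAnalyticLoop

variable {z : ℝ → ℂ}

lemma analyticAt_log_norm_sub (hz : IsAnalyticLoop z) {t τ : ℝ} (h : z τ ≠ z t) :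
    AnalyticAt ℝ (fun σ => log ‖z σ - z t‖) τ :=
  analyticAt_log_norm ((hz.analytic τ).sub analyticAt_const) (sub_ne_zero.2 h)

/-- The chord factors as (τ - t) times a nonvanishing analytic function; `log (τ - t)` means log|τ -
t|. -/
lemma exists_log_norm_sub_eq (hz : IsAnalyticLoop z) (t : ℝ) : ∃ ℓ : ℝ → ℝ, AnalyticAt ℝ ℓ t ∧
    ∀ᶠ τ in 𝓝[≠] t, log ‖z τ - z t‖ = log (τ - t) + ℓ τ := by
  have h0 : dslope z t t ≠ 0 := by rw [dslope_same]; exact hz.regular t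
  refine ⟨fun τ => log ‖dslope z t τ‖, analyticAt_log_norm (hz.analyticAt_dslope t t) h0, ?_⟩
  have h1 : ∀ᶠ τ in 𝓝[≠] t, dslope z t τ ≠ 0 := eventually_nhdsWithin_of_eventually_nhds
    ((hz.analyticAt_dslope t t).continuousAt.eventually_ne h0)
  filter_upwards [h1, self_mem_nhdsWithin] with τ hτ hne
  have hne' : τ - t ≠ 0 := sub_ne_zero.2 hne
  rw [sub_eq_mul_dslope, norm_mul, Complex.norm_real, Real.norm_eq_abs,
    log_mul (abs_ne_zero.2 hne') (norm_ne_zero_iff.2 hτ), log_abs]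

/-- The logarithmic kernel times a density is at most logarithmically singular. -/
lemma isBigO_log_norm_sub_mul (hz : IsAnalyticLoop z) {f : ℝ → ℝ} (hf : Continuous f) (t τ : ℝ) :
    (fun σ => log ‖z σ - z t‖ * f σ) =O[𝓝[≠] τ] fun σ => log (σ - τ) := by
  by_cases h : z τ = z t
  · obtain ⟨ℓ, hℓ, heq⟩ := hz.exists_log_norm_sub_eq τ
    rw [h] at heq
    refine ((isBigO_log_mul hf.continuousAt).add (isBigO_log_of_continuousAt
      (hℓ.continuousAt.mul hf.continuousAt))).congr' ?_ EventuallyEq.rfl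
    filter_upwards [heq] with σ hσ
    rw [hσ, Pi.mul_apply]; ring
  · exact isBigO_log_of_continuousAt
      ((hz.analyticAt_log_norm_sub h).continuousAt.mul hf.continuousAt)

lemma intervalIntegrable_log_norm_sub_mul (hz : IsAnalyticLoop z) {f : ℝ → ℝ} (hf : Continuous f)
    (t a b : ℝ) :
    IntervalIntegrable (fun σ => log ‖z σ - z t‖ * f σ) volume a b := by
  refine intervalIntegrable_of_locallyIntegrable (locallyIntegrable_of_isBigO_log ?_
    fun τ => hz.isBigO_log_norm_sub_mul hf t τ) a b
  have := hz.continuous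
  exact (measurable_log.comp (by fun_prop : Continuous fun σ => ‖z σ - z t‖).measurable).mul
    hf.measurable

/-- Regularity of the logarithmic kernel times a density that vanishes at the singularity. -/
lemma log_norm_sub_mul_regularity (hz : IsAnalyticLoop z) {ψ : ℝ → ℝ} {t : ℝ} {M : ℕ}
    (hψ : AnalyticAt ℝ ψ t)
    (h0 : ∀ m ≤ M, iteratedDeriv m ψ t = 0) :
    ContDiffAt ℝ M (fun σ => log ‖z σ - z t‖ * ψ σ) t ∧
      iteratedDeriv (M + 1) (fun σ => log ‖z σ - z t‖ * ψ σ) =O[𝓝[≠] t]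
        fun σ => log (σ - t) := by
  obtain ⟨ℓ, hℓ, heq⟩ := hz.exists_log_norm_sub_eq t
  -- Vanishing of the derivatives of orders 0 to M is a zero of order at least M + 1.
  obtain ⟨g, hg, hgeq⟩ := (natCast_le_analyticOrderAt hψ).1
    ((natCast_le_analyticOrderAt_iff_iteratedDeriv_eq_zero hψ (n := M + 1)).2
      fun i hi => h0 i (Nat.lt_succ_iff.1 hi))
  refine pow_mul_log_regularity M hg (hℓ.mul hψ) ?_
  have h1 : ∀ᶠ σ in 𝓝 t, σ ≠ t → log ‖z σ - z t‖ = log (σ - t) + ℓ σ :=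
    eventually_nhdsWithin_iff.1 heq
  filter_upwards [h1, hgeq] with σ hσ hgσ
  rcases eq_or_ne σ t with rfl | hne
  · have : ψ σ = 0 := by simpa using h0 0 (Nat.zero_le _)
    simp [this]
  · rw [hσ hne, Pi.mul_apply, add_mul]
    congr 1
    rw [hgσ, smul_eq_mul]; ring

end IsAnalyticLoop

/-! ### Green's third identity at a boundary point -/

/-- Continuity of |w| log|w| at zeros of w. It carries the antiderivative in Green's identity across
the singular point. -/
lemma continuous_log_norm_mul_im_mul {w h : ℝ → ℂ} (hw : Continuous w) (hh : Continuous h) :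
    Continuous fun τ => log ‖w τ‖ * (w τ * h τ).im := by
  rw [continuous_iff_continuousAt]
  intro t
  by_cases h0 : w t = 0
  · have h1 : Tendsto (fun τ => ‖‖w τ‖ * log ‖w τ‖‖ * ‖h τ‖) (𝓝 t) (𝓝 0) := by
      have : Continuous fun τ => ‖‖w τ‖ * log ‖w τ‖‖ * ‖h τ‖ :=
        (continuous_mul_log.comp hw.norm).norm.mul hh.norm
      exact this.tendsto' t 0 (by simp [h0])
    rw [ContinuousAt, h0, norm_zero, log_zero, zero_mul]
    refine squeeze_zero_norm (fun τ => ?_) h1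
    calc ‖log ‖w τ‖ * (w τ * h τ).im‖ = ‖log ‖w τ‖‖ * |(w τ * h τ).im| := norm_mul _ _
      _ ≤ ‖log ‖w τ‖‖ * ‖w τ * h τ‖ := by gcongr; exact Complex.abs_im_le_norm _
      _ = ‖‖w τ‖ * log ‖w τ‖‖ * ‖h τ‖ := by
        rw [norm_mul (w τ), norm_mul ‖w τ‖, norm_norm]; ring
  · exact (hw.continuousAt.norm.log (norm_ne_zero_iff.2 h0)).mul
      (Complex.continuous_im.continuousAt.comp (hw.continuousAt.mul hh.continuousAt))

lemma hasDerivAt_log_norm {w : ℝ → ℂ} {w' : ℂ} {t : ℝ} (hw : HasDerivAt w w' t) (h0 : w t ≠ 0) :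
    HasDerivAt (fun τ => log ‖w τ‖) (w' / w t).re t := by
  have h1 : (fun τ => log ‖w τ‖) = fun τ => log (‖w τ‖ ^ 2) / 2 := by
    ext τ; rw [log_pow]; push_cast; ring
  rw [h1]
  have h2 := (hw.norm_sq.log (by simpa using h0)).div_const 2
  refine h2.congr_deriv ?_
  rw [Complex.inner, Complex.div_re, ← add_div, Complex.sq_norm]
  have := Complex.normSq_pos.2 h0
  simp only [Complex.mul_re, Complex.conj_re, Complex.conj_im]
  field_simp
  ring

namespace IsAnalyticLoop

variable {z : ℝ → ℂ}

lemma periodic_angleKernel (hz : IsAnalyticLoop z) (t : ℝ) : Function.Periodic (angleKernel z t)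
    (2 * π) := fun τ => by
  simp only [angleKernel, hz.periodic τ, hz.periodic_deriv τ]

/-- Green's third identity at a boundary point, for the real part of an entire function. -/
theorem integral_log_norm_sub_mul (hz : IsAnalyticLoop z) {t : ℝ} (ht : totalAngle z t = π)
    {F : ℂ → ℂ}
    (hF : Differentiable ℂ F) :
    ∫ τ in (0 : ℝ)..(2 * π), log ‖z τ - z t‖ * (deriv F (z τ) * deriv z τ).im =
      (∫ τ in (0 : ℝ)..(2 * π), angleKernel z t τ * (F (z τ)).re) - π * (F (z t)).re := by
  have hle : t - π ≤ t + π := by linarith [pi_pos]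
  have hFan : ∀ w, AnalyticAt ℂ F w := fun w => hF.analyticAt w
  set H : ℂ → ℂ := dslope F (z t) with hHdef
  have hH : Differentiable ℂ H := fun w =>
    (LayerPotential.analyticAt_dslope (hFan (z t)) (hFan w)).differentiableAt
  obtain ⟨P, hP⟩ := hH.isExactOn_univ
  have hFH : ∀ w, F w - F (z t) = (w - z t) * H w := fun w => by
    rw [← smul_eq_mul, hHdef, sub_smul_dslope]
  have hzc := hz.continuous
  have hzd := hz.continuous_deriv
  have hF'c : Continuous (deriv F) :=
    continuous_iff_continuousAt.2 fun w => (hFan w).deriv.continuousAt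
  have hdens : Continuous fun τ => (deriv F (z τ) * deriv z τ).im :=
    Complex.continuous_im.comp ((hF'c.comp hzc).mul hzd)
  set k : ℝ → ℝ := fun τ => (deriv (dslope z t) τ / dslope z t τ).im with hk
  have hkc : ContinuousOn k (uIcc (t - π) (t + π)) := by
    rw [uIcc_of_le hle]
    exact Complex.continuous_im.comp_continuousOn (hz.continuousOn_logDeriv_dslope t)
  have hRe : Continuous fun τ => (F (z τ)).re :=
    Complex.continuous_re.comp (hF.continuous.comp hzc)
  have i1 := hz.intervalIntegrable_log_norm_sub_mul hdens t (t - π) (t + π)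
  have i2 : IntervalIntegrable (fun τ => k τ * (F (z τ)).re) volume (t - π) (t + π) :=
    (hkc.mul hRe.continuousOn).intervalIntegrable
  have i3 : IntervalIntegrable (fun τ => k τ * (F (z t)).re) volume (t - π) (t + π) :=
    (hkc.mul continuousOn_const).intervalIntegrable
  -- The real part of z'/(z - z t) from the logarithm cancels against P', leaving -Im(z'/(z - z t))
  -- · Re(F(z) - F(z t)). Only τ = t lacks a derivative.
  have hftc := integral_eq_of_hasDerivAt_off_countable_of_le
    (fun τ => log ‖z τ - z t‖ * ((z τ - z t) * H (z τ)).im - (P (z τ)).im)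
    (fun τ => log ‖z τ - z t‖ * (deriv F (z τ) * deriv z τ).im - k τ * (F (z τ)).re
      + k τ * (F (z t)).re) hle (countable_singleton t) ?_ ?_ ((i1.sub i2).add i3)
  · have hper : z (t + π) = z (t - π) := by
      rw [← hz.periodic (t - π)]; congr 1; ring
    -- The end values agree, so the integral is 0; its constant part is Re F(z t) times the total
    -- angle π.
    rw [hper, sub_self, intervalIntegral.integral_add (i1.sub i2) i3,
      intervalIntegral.integral_sub i1 i2, intervalIntegral.integral_mul_const,
      ← hz.totalAngle_eq, ht, ← hz.integral_angleKernel_mul t (fun τ => (F (z τ)).re)] at hftc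
    rw [← integral_symm_eq_of_periodic (t := t), ← integral_symm_eq_of_periodic (t := t)]
    · linarith
    · intro τ
      simp only [hz.periodic_angleKernel t τ, hz.periodic τ]
    · intro τ
      simp only [hz.periodic τ, hz.periodic_deriv τ]
  · refine Continuous.continuousOn (Continuous.sub (continuous_log_norm_mul_im_mul
      (hzc.sub continuous_const) (hH.continuous.comp hzc)) (Complex.continuous_im.comp ?_))
    exact (Differentiable.continuous fun w =>
      (hP w (mem_univ w)).differentiableAt).comp hzc
  · rintro τ ⟨hτ, hne⟩
    have hlt : |τ - t| < 2 * π := by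
      rw [abs_lt]; constructor <;> linarith [hτ.1, hτ.2, pi_pos]
    have hne' : z τ - z t ≠ 0 := fun h =>
      hne ((hz.eq_iff.1 (sub_eq_zero.1 h)).eq_of_abs_lt hlt)
    have hzτ := (hz.differentiable τ).hasDerivAt
    have hFz : HasDerivAt (fun σ => F (z σ)) (deriv F (z τ) * deriv z τ) τ :=
      (hF (z τ)).hasDerivAt.comp_of_eq τ hzτ rfl
    have hPz : HasDerivAt (fun σ => P (z σ)) (H (z τ) * deriv z τ) τ :=
      (hP (z τ) (mem_univ _)).comp_of_eq τ hzτ rfl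
    have hFz' : HasDerivAt (fun σ => (z σ - z t) * H (z σ)) (deriv F (z τ) * deriv z τ) τ := by
      simp_rw [← hFH]
      exact hFz.sub_const _
    have him : ∀ {f : ℝ → ℂ} {f' : ℂ}, HasDerivAt f f' τ →
        HasDerivAt (fun σ => (f σ).im) f'.im τ := fun hf =>
      Complex.imCLM.hasFDerivAt.comp_hasDerivAt τ hf
    have hd := ((hasDerivAt_log_norm (hzτ.sub_const (z t)) hne').mul (him hFz')).sub (him hPz)
    refine hd.congr_deriv ?_
    have hH' : H (z τ) * deriv z τ = (F (z τ) - F (z t)) * (deriv z τ / (z τ - z t)) := by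
      rw [hFH]; field_simp
    rw [hH', ← hFH, hk]
    simp only
    rw [← hz.angleKernel_eq hne hlt, angleKernel]
    simp only [Complex.mul_im, Complex.sub_im, Complex.sub_re]
    ring

end IsAnalyticLoop

/-! ### Harmonic functions on the plane as real parts -/

/-- The identification of the Euclidean plane with `ℂ`. -/
def toComplex : Plane ≃ₗᵢ[ℝ] ℂ := Complex.orthonormalBasisOneI.repr.symm

lemma toComplex_apply (v : Plane) : toComplex v = v 0 + v 1 * Complex.I := by
  simp [toComplex, Complex.coe_orthonormalBasisOneI,
    ← OrthonormalBasis.sum_repr_symm, Fin.sum_univ_two]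

@[simp] lemma toComplex_re (v : Plane) : (toComplex v).re = v 0 := by simp [toComplex_apply]

@[simp] lemma toComplex_im (v : Plane) : (toComplex v).im = v 1 := by simp [toComplex_apply]

lemma inner_eq_re (v w : Plane) :
    inner ℝ v w = (starRingEnd ℂ (toComplex v) * toComplex w).re := by
  rw [← toComplex.inner_map_map, Complex.inner]
  ring_nf

lemma hasDerivAt_toComplex {x : ℝ → Plane} {v : Plane} {τ : ℝ} (h : HasDerivAt x v τ) :
    HasDerivAt (fun σ => toComplex (x σ)) (toComplex v) τ :=
  toComplex.toContinuousLinearEquiv.hasFDerivAt.comp_hasDerivAt τ h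

/-- The Laplacian may be computed in any orthonormal basis, and the isometry carries one such basis
to another. -/
lemma harmonicOnNhd_comp_toComplex_symm {f : Plane → ℝ} (hf : HarmonicOnNhd f univ) :
    HarmonicOnNhd (f ∘ toComplex.symm) univ := by
  have hcd : ContDiff ℝ 2 f := contDiffOn_univ.1 hf.contDiffOn
  intro w _
  refine ⟨(hcd.comp toComplex.symm.contDiff).contDiffAt, Eventually.of_forall fun y => ?_⟩
  have h0 := (hf (toComplex.symm y) (mem_univ _)).2.self_of_nhds
  rw [laplacian_eq_iteratedFDeriv_orthonormalBasis f
    (Complex.orthonormalBasisOneI.map toComplex.symm)] at h0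
  rw [laplacian_eq_iteratedFDeriv_orthonormalBasis _ Complex.orthonormalBasisOneI]
  have h1 := ContinuousLinearMap.iteratedFDeriv_comp_right
    (toComplex.symm.toContinuousLinearEquiv : ℂ →L[ℝ] Plane) hcd y (i := 2) le_rfl
  have h2 : f ∘ toComplex.symm =
      f ∘ (toComplex.symm.toContinuousLinearEquiv : ℂ →L[ℝ] Plane) := rfl
  rw [h2]
  simp only [h1]
  refine Eq.trans ?_ h0
  refine Finset.sum_congr rfl fun i _ => ?_
  rw [ContinuousMultilinearMap.compContinuousLinearMap_apply]
  congr 1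
  ext j
  fin_cases j <;> simp

/-- A harmonic function on the plane is the real part of an entire function. -/
lemma exists_entire_re_eq {f : Plane → ℝ} (hf : HarmonicOnNhd f univ) :
    ∃ F : ℂ → ℂ, Differentiable ℂ F ∧ ∀ v, f v = (F (toComplex v)).re := by
  obtain ⟨F, hF, heq⟩ := (harmonicOnNhd_comp_toComplex_symm hf).exists_analyticOnNhd_univ_re_eq
  refine ⟨F, fun w => (hF w (mem_univ w)).differentiableAt, fun v => ?_⟩
  have := congrFun heq (toComplex v)
  simpa using this.symm

lemma inner_gradient_re {F : ℂ → ℂ} (hF : Differentiable ℂ F) (y v : Plane) :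
    inner ℝ (gradient (fun w => (F (toComplex w)).re) y) v =
      (deriv F (toComplex y) * toComplex v).re := by
  have h1 := Complex.reCLM.hasFDerivAt.comp y
    (((hF (toComplex y)).hasDerivAt.hasFDerivAt.restrictScalars ℝ).comp y
      toComplex.toContinuousLinearEquiv.hasFDerivAt)
  rw [← toDual_apply_apply, toDual_gradient]
  have h2 : (fun w => (F (toComplex w)).re) =
      Complex.reCLM ∘ F ∘ toComplex := rfl
  rw [h2, h1.fderiv]
  simp [mul_comm]

lemma analyticAt_norm {f : ℝ → ℂ} {t : ℝ} (hf : AnalyticAt ℝ f t) (h0 : f t ≠ 0) :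
    AnalyticAt ℝ (fun τ => ‖f τ‖) t := by
  refine (analyticAt_rexp.comp (analyticAt_log_norm hf h0)).congr ?_
  filter_upwards [hf.continuousAt.eventually_ne h0] with τ hτ
  exact exp_log (norm_pos_iff.2 hτ)

lemma sameParam_add_two_pi {τ t : ℝ} : SameParam (τ + 2 * π) t ↔ SameParam τ t := by
  constructor
  · rintro ⟨k, hk⟩
    exact ⟨k - 1, by push_cast; linarith⟩
  · rintro ⟨k, hk⟩
    exact ⟨k + 1, by push_cast; linarith⟩

lemma countable_sameParam (t : ℝ) : {τ | SameParam τ t}.Countable := by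
  refine (countable_range fun k : ℤ => t + k * (2 * π)).mono ?_
  rintro τ ⟨k, hk⟩
  exact ⟨k, hk.symm⟩

/-! ### The kernels of the plane curve -/

namespace IsAnalyticJordanParam

variable {x : ℝ → Plane}

lemma hasDerivAt (hx : IsAnalyticJordanParam x) (τ : ℝ) : HasDerivAt x (deriv x τ) τ :=
  (hx.analytic τ (mem_univ τ)).differentiableAt.hasDerivAt

lemma deriv_toComplex (hx : IsAnalyticJordanParam x) : deriv (fun τ => toComplex
    (x τ)) = fun τ => toComplex (deriv x τ) :=
  funext fun τ => (hasDerivAt_toComplex (hx.hasDerivAt τ)).deriv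

lemma isAnalyticLoop (hx : IsAnalyticJordanParam x) : IsAnalyticLoop fun τ => toComplex (x τ) where
  analytic τ := (toComplex.toContinuousLinearEquiv.toContinuousLinearMap.analyticAt _).comp
    (hx.analytic τ (mem_univ τ))
  periodic τ := by simp only [hx.periodic τ]
  regular τ := by
    rw [hx.deriv_toComplex]
    simpa using hx.regular τ
  simple := fun a ha b hb h => hx.simple ha hb (toComplex.injective h)

lemma deriv_deriv_toComplex (hx : IsAnalyticJordanParam x) (τ : ℝ) :
    deriv (deriv fun τ => toComplex (x τ)) τ = toComplex (deriv (deriv x) τ) := by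
  rw [hx.deriv_toComplex]
  exact (hasDerivAt_toComplex
    ((hx.analytic τ (mem_univ τ)).deriv.differentiableAt.hasDerivAt)).deriv

lemma periodic_deriv (hx : IsAnalyticJordanParam x) : Function.Periodic (deriv x)
    (2 * π) := fun τ => by
  have h : (fun s => x (s + 2 * π)) = x := funext hx.periodic
  rw [← deriv_comp_add_const, h]

lemma periodic_unitNormal (hx : IsAnalyticJordanParam x) : Function.Periodic (unitNormal x)
    (2 * π) := fun τ => by
  simp only [unitNormal, hx.periodic_deriv τ]

lemma windingAngle_toComplex (hx : IsAnalyticJordanParam x) (p : Plane) :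
    windingAngle (fun τ => toComplex (x τ)) (toComplex p) = 2 * π * windingNumber x p := by
  rw [windingNumber, ← mul_assoc, mul_one_div_cancel two_pi_pos.ne', one_mul, windingAngle]
  refine integral_congr fun τ _ => ?_
  simp only [hx.deriv_toComplex]
  rw [← map_sub, Complex.div_im, ← Complex.sq_norm, toComplex.norm_map]
  simp only [toComplex_re, toComplex_im, PiLp.sub_apply]
  ring

/-- The angle under which a counterclockwise curve is seen from its own points is `π`. -/
lemma totalAngle_eq_pi (hx : IsAnalyticJordanParam x) (t : ℝ) : totalAngle (fun τ => toComplex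
    (x τ)) t = π := by
  obtain ⟨p, hp, hw⟩ := hx.counterclockwise
  refine hx.isAnalyticLoop.totalAngle_eq_pi (p := toComplex p) ?_ ?_ t
  · rintro ⟨τ, hτ⟩
    exact hp ⟨τ, toComplex.injective hτ⟩
  · rw [hx.windingAngle_toComplex, hw, mul_one]

lemma toComplex_unitNormal (τ : ℝ) : toComplex (unitNormal x τ) =
    (‖toComplex (deriv x τ)‖⁻¹ : ℝ) * (-Complex.I * toComplex (deriv x τ)) := by
  rw [unitNormal, map_smul, Complex.real_smul, toComplex.norm_map]
  congr 1
  apply Complex.ext <;> simp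

lemma inner_unitNormal (v : Plane) (τ : ℝ) : inner ℝ v (unitNormal x τ) =
    ‖toComplex (deriv x τ)‖⁻¹ *
      (starRingEnd ℂ (toComplex v) * toComplex (deriv x τ)).im := by
  rw [inner_eq_re, toComplex_unitNormal, mul_left_comm, Complex.re_ofReal_mul]
  congr 1
  simp [Complex.mul_re, Complex.mul_im]
  ring

lemma conj_mul_im_div (w v : ℂ) : (starRingEnd ℂ w * v).im / ‖w‖ ^ 2 = (v / w).im := by
  rw [Complex.div_im, Complex.sq_norm, ← sub_div]
  congr 1
  simp [Complex.mul_im]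
  ring

lemma kernelP_of_not_sameParam (hx : IsAnalyticJordanParam x) {U : Plane → Plane → ℝ} {τ t : ℝ}
    (h : ¬ SameParam τ t) :
    kernelP x U τ t = -(1 / (2 * π)) * ‖deriv (fun σ => toComplex (x σ)) τ‖⁻¹ *
      angleKernel (fun σ => toComplex (x σ)) t τ * U (x τ) (x t) := by
  rw [kernelP, if_neg h, inner_unitNormal, dirichletTrace, angleKernel, hx.deriv_toComplex]
  rw [← conj_mul_im_div, ← map_sub, toComplex.norm_map (x τ - x t), norm_sub_rev (x τ)]
  have : toComplex (x τ - x t) = -toComplex (x t - x τ) := by rw [← map_neg, neg_sub]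
  rw [this, map_neg, neg_mul (starRingEnd ℂ _), Complex.neg_im]
  ring

/-- With d the divided difference, differentiating z' = d + (τ - t) d' at t gives z'' = 2 d'; this
turns 2π into the 4π of the diagonal value. -/
lemma deriv_dslope_self (hx : IsAnalyticJordanParam x) (t : ℝ) :
    deriv (dslope (fun σ => toComplex (x σ)) t) t = toComplex (deriv (deriv x) t) / 2 := by
  have hz := hx.isAnalyticLoop
  set z : ℝ → ℂ := fun σ => toComplex (x σ) with hzdef
  have h1 : deriv z = fun τ : ℝ => dslope z t τ + ((τ : ℂ) - t) * deriv (dslope z t) τ :=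
    funext fun τ => hz.deriv_eq_dslope t τ
  have h2 : HasDerivAt (fun τ : ℝ => dslope z t τ + ((τ : ℂ) - t) * deriv (dslope z t) τ)
      (deriv (dslope z t) t + (1 * deriv (dslope z t) t
        + ((t : ℂ) - t) * deriv (deriv (dslope z t)) t)) t :=
    (hz.analyticAt_dslope t t).differentiableAt.hasDerivAt.add
      ((Complex.ofRealCLM.hasDerivAt.sub_const _).mul
        (hz.analyticAt_dslope t t).deriv.differentiableAt.hasDerivAt)
  rw [← h1] at h2
  have h3 := h2.deriv
  rw [hx.deriv_deriv_toComplex] at h3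
  rw [h3]; ring

lemma kernelP_of_sameParam (hx : IsAnalyticJordanParam x) {U : Plane → Plane → ℝ} {τ t : ℝ}
    (h : SameParam τ t) :
    kernelP x U τ t = -(1 / (2 * π)) * ‖deriv (fun σ => toComplex (x σ)) τ‖⁻¹ *
      (deriv (dslope (fun σ => toComplex (x σ)) τ) τ /
        dslope (fun σ => toComplex (x σ)) τ τ).im * U (x τ) (x t) := by
  have hper : ∀ {f : ℝ → Plane}, Function.Periodic f (2 * π) → f τ = f t := fun hf => by
    obtain ⟨k, rfl⟩ := h
    exact hf.int_mul k t
  have hp2 : Function.Periodic (deriv (deriv x)) (2 * π) := fun τ => by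
    have h : (fun s => deriv x (s + 2 * π)) = deriv x := funext hx.periodic_deriv
    rw [← deriv_comp_add_const, h]
  rw [kernelP, if_pos h, dirichletTrace, ← hper hx.periodic, ← hper hx.periodic_deriv,
    ← hper hp2, ← hper hx.periodic_unitNormal, dslope_same, hx.deriv_dslope_self,
    inner_unitNormal, hx.deriv_toComplex]
  have h1 : ((toComplex (deriv (deriv x) τ) / 2) / toComplex (deriv x τ)).im =
      -((starRingEnd ℂ (toComplex (deriv (deriv x) τ)) * toComplex (deriv x τ)).im
        / ‖deriv x τ‖ ^ 2) / 2 := by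
    rw [div_right_comm, show (2 : ℂ) = ((2 : ℝ) : ℂ) by simp, Complex.div_ofReal_im,
      ← conj_mul_im_div, toComplex.norm_map, ← neg_div]
    congr 2
    simp [Complex.mul_im]
    ring
  rw [h1]
  have := pi_pos.ne'
  have := norm_ne_zero_iff.2 (hx.regular τ)
  field_simp
  ring

/-- Near a parameter congruent to t, both branches agree with one expression in the divided
difference centred at that parameter. -/
lemma analyticAt_kernelP (hx : IsAnalyticJordanParam x) {U : Plane → Plane → ℝ} {t : ℝ}
    (hU : ∀ τ, AnalyticAt ℝ (fun σ => U (x σ) (x t)) τ) (τ : ℝ) :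
    AnalyticAt ℝ (fun σ => kernelP x U σ t) τ := by
  have hz := hx.isAnalyticLoop
  set z : ℝ → ℂ := fun σ => toComplex (x σ) with hzdef
  have hn : AnalyticAt ℝ (fun σ => -(1 / (2 * π)) * ‖deriv z σ‖⁻¹) τ :=
    analyticAt_const.mul ((analyticAt_norm (hz.analyticAt_deriv τ) (hz.regular τ)).inv
      (norm_ne_zero_iff.2 (hz.regular τ)))
  have him : ∀ {f : ℝ → ℂ}, AnalyticAt ℝ f τ → AnalyticAt ℝ (fun σ => (f σ).im) τ := fun hf =>
    (Complex.imCLM.analyticAt _).comp hf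
  by_cases h : SameParam τ t
  · have hzt : z τ = z t := hz.eq_of_sameParam h
    have ha : AnalyticAt ℝ (fun σ => (deriv (dslope z τ) σ / dslope z τ σ).im) τ :=
      him ((hz.analyticAt_dslope τ τ).deriv.div (hz.analyticAt_dslope τ τ)
        (hz.dslope_ne_zero (by simpa using pi_pos)))
    refine ((hn.mul ha).mul (hU τ)).congr ?_
    have hnear : ∀ᶠ σ in 𝓝 τ, |σ - τ| < 2 * π := by
      have : Continuous fun σ : ℝ => |σ - τ| := by fun_prop
      exact (this.tendsto' τ 0 (by simp)).eventually (gt_mem_nhds two_pi_pos)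
    filter_upwards [hnear] with σ hσ
    rcases eq_or_ne σ τ with rfl | hne
    · simp only [Pi.mul_apply]
      rw [hx.kernelP_of_sameParam h]
    · have hns : ¬ SameParam σ t := fun hs => hne
        ((hz.eq_iff.1 ((hz.eq_of_sameParam hs).trans hzt.symm)).eq_of_abs_lt hσ)
      simp only [Pi.mul_apply]
      rw [hx.kernelP_of_not_sameParam hns, ← hz.angleKernel_eq hne hσ, angleKernel, angleKernel,
        hzt]
  · have hne : z τ - z t ≠ 0 := fun h' => h (hz.eq_iff.1 (sub_eq_zero.1 h'))
    have ha : AnalyticAt ℝ (angleKernel z t) τ :=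
      him ((hz.analyticAt_deriv τ).div ((hz.analytic τ).sub analyticAt_const) hne)
    refine ((hn.mul ha).mul (hU τ)).congr ?_
    filter_upwards [((hz.continuous.sub continuous_const).continuousAt.eventually_ne hne)]
      with σ hσ
    simp only [Pi.mul_apply]
    rw [hx.kernelP_of_not_sameParam fun hs => hσ (sub_eq_zero.2 (hz.eq_of_sameParam hs))]

lemma periodic_kernelP (hx : IsAnalyticJordanParam x) (U : Plane → Plane → ℝ) (t : ℝ) :
    Function.Periodic (fun τ => kernelP x U τ t) (2 * π) := fun τ => by
  simp only [kernelP, dirichletTrace, hx.periodic τ, hx.periodic_unitNormal τ]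
  by_cases h : SameParam τ t
  · rw [if_pos h, if_pos (sameParam_add_two_pi.2 h)]
  · rw [if_neg h, if_neg (mt sameParam_add_two_pi.1 h)]

lemma periodic_neumannTrace (hx : IsAnalyticJordanParam x) (U : Plane → Plane → ℝ) (t : ℝ) :
    Function.Periodic (fun τ => neumannTrace x U τ t) (2 * π) := fun τ => by
  simp only [neumannTrace, hx.periodic τ, hx.periodic_unitNormal τ]

/-- The case distinction disappears because `log 0 = 0`. -/
lemma kernelQ_eq (hx : IsAnalyticJordanParam x) (φ : ℝ → ℝ) (U : Plane → Plane → ℝ) (τ t : ℝ) :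
    kernelQ x φ U τ t = log ‖toComplex (x τ) - toComplex (x t)‖ *
      ((1 / (2 * π)) * (neumannTrace x U τ t - φ τ)) := by
  rw [← map_sub, toComplex.norm_map, kernelQ]
  split_ifs with h
  · have : x τ = x t := toComplex.injective (hx.isAnalyticLoop.eq_of_sameParam h)
    simp [this]
  · rw [norm_sub_rev]; ring

/-- Cauchy–Riemann: the normal derivative of Re F is the tangential derivative of Im F. -/
lemma neumannTrace_mul_norm (hx : IsAnalyticJordanParam x) {U : Plane → Plane → ℝ} {t : ℝ}
    {F : ℂ → ℂ}
    (hF : Differentiable ℂ F) (hUF : ∀ v, U v (x t) = (F (toComplex v)).re) (τ : ℝ) :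
    neumannTrace x U τ t * ‖deriv (fun σ => toComplex (x σ)) τ‖ =
      (deriv F (toComplex (x τ)) * deriv (fun σ => toComplex (x σ)) τ).im := by
  have h0 := hx.isAnalyticLoop.regular τ
  rw [hx.deriv_toComplex] at h0 ⊢
  have h1 : (fun v => U v (x t)) = fun v => (F (toComplex v)).re := funext hUF
  have h2 : deriv F (toComplex (x τ)) * ((‖toComplex (deriv x τ)‖⁻¹ : ℝ) *
      (-Complex.I * toComplex (deriv x τ))) = (‖toComplex (deriv x τ)‖⁻¹ : ℝ) *
      (-Complex.I * (deriv F (toComplex (x τ)) * toComplex (deriv x τ))) := by ring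
  rw [neumannTrace, h1, inner_gradient_re hF, toComplex_unitNormal, h2, Complex.re_ofReal_mul]
  have h3 := norm_ne_zero_iff.2 h0
  rw [mul_comm, ← mul_assoc, mul_inv_cancel₀ h3, one_mul]
  simp

lemma analyticAt_neumannTrace (hx : IsAnalyticJordanParam x) {U : Plane → Plane → ℝ} {t : ℝ}
    {F : ℂ → ℂ}
    (hF : Differentiable ℂ F) (hUF : ∀ v, U v (x t) = (F (toComplex v)).re) (τ : ℝ) :
    AnalyticAt ℝ (fun σ => neumannTrace x U σ t) τ := by
  have hz := hx.isAnalyticLoop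
  have h1 : (fun σ => neumannTrace x U σ t) = fun σ =>
      (deriv F (toComplex (x σ)) * deriv (fun σ => toComplex (x σ)) σ).im *
        ‖deriv (fun σ => toComplex (x σ)) σ‖⁻¹ := by
    ext σ
    rw [← hx.neumannTrace_mul_norm hF hUF, mul_inv_cancel_right₀
      (norm_ne_zero_iff.2 (hz.regular σ))]
  rw [h1]
  refine AnalyticAt.mul ((Complex.imCLM.analyticAt _).comp (AnalyticAt.mul ?_
    (hz.analyticAt_deriv τ))) ((analyticAt_norm (hz.analyticAt_deriv τ) (hz.regular τ)).inv
      (norm_ne_zero_iff.2 (hz.regular τ)))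
  exact ((hF.analyticAt (toComplex (x τ))).deriv.restrictScalars (𝕜 := ℝ)).comp
    (g := deriv F) (f := fun σ => toComplex (x σ)) (hz.analytic τ)

end IsAnalyticJordanParam

namespace IsAnalyticLoop

variable {z : ℝ → ℂ}

lemma iteratedDeriv_eq_zero_of_sameParam (hz : IsAnalyticLoop z) {ψ : ℝ → ℝ} {t τ : ℝ} {M : ℕ}
    (hper : Function.Periodic ψ (2 * π)) (h0 : ∀ m ≤ M, iteratedDeriv m ψ t = 0)
    (h : z τ = z t) : ∀ m ≤ M, iteratedDeriv m ψ τ = 0 := fun m hm => by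
  obtain ⟨k, rfl⟩ := hz.eq_iff.1 h
  rw [← h0 m hm]
  exact (periodic_iteratedDeriv hper m).int_mul k t

lemma contDiff_log_norm_sub_mul (hz : IsAnalyticLoop z) {ψ : ℝ → ℝ} {t : ℝ} {M : ℕ}
    (hψ : ∀ τ, AnalyticAt ℝ ψ τ)
    (hper : Function.Periodic ψ (2 * π)) (h0 : ∀ m ≤ M, iteratedDeriv m ψ t = 0) :
    ContDiff ℝ M fun σ => log ‖z σ - z t‖ * ψ σ := by
  rw [contDiff_iff_contDiffAt]
  intro τ
  by_cases h : z τ = z t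
  · rw [← h]
    exact (hz.log_norm_sub_mul_regularity (hψ τ)
      (hz.iteratedDeriv_eq_zero_of_sameParam hper h0 h)).1
  · exact ((hz.analyticAt_log_norm_sub h).mul (hψ τ)).contDiffAt

lemma isBigO_iteratedDeriv_log_norm_sub_mul (hz : IsAnalyticLoop z) {ψ : ℝ → ℝ} {t : ℝ} {M : ℕ}
    (hψ : ∀ τ, AnalyticAt ℝ ψ τ) (hper : Function.Periodic ψ (2 * π))
    (h0 : ∀ m ≤ M, iteratedDeriv m ψ t = 0) (τ : ℝ) :
    iteratedDeriv (M + 1) (fun σ => log ‖z σ - z t‖ * ψ σ) =O[𝓝[≠] τ]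
      fun σ => log (σ - τ) := by
  by_cases h : z τ = z t
  · rw [← h]
    exact (hz.log_norm_sub_mul_regularity (hψ τ)
      (hz.iteratedDeriv_eq_zero_of_sameParam hper h0 h)).2
  · exact isBigO_log_of_continuousAt (analyticAt_iteratedDeriv
      ((hz.analyticAt_log_norm_sub h).mul (hψ τ)) (M + 1)).continuousAt

end IsAnalyticLoop

namespace IsAnalyticJordanParam

variable {x : ℝ → Plane}

lemma analyticAt_dirichletTrace (hx : IsAnalyticJordanParam x) {U : Plane → Plane → ℝ} {t : ℝ}
    {F : ℂ → ℂ}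
    (hF : Differentiable ℂ F) (hUF : ∀ v, U v (x t) = (F (toComplex v)).re) (τ : ℝ) :
    AnalyticAt ℝ (fun σ => U (x σ) (x t)) τ := by
  simp only [hUF]
  exact (Complex.reCLM.analyticAt _).comp (((hF.analyticAt (toComplex (x τ))).restrictScalars
    (𝕜 := ℝ)).comp (g := F) (f := fun σ => toComplex (x σ)) (hx.isAnalyticLoop.analytic τ))

lemma norm_deriv_eq (hx : IsAnalyticJordanParam x) (τ : ℝ) : ‖deriv x τ‖ = ‖deriv
    (fun σ => toComplex (x σ)) τ‖ := by
  rw [hx.deriv_toComplex, toComplex.norm_map]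

lemma singleLayerIntegrand_eq (hx : IsAnalyticJordanParam x) (φ : ℝ → ℝ)
    (t : ℝ) : singleLayerIntegrand x φ t =
    fun τ => log ‖toComplex (x τ) - toComplex (x t)‖ *
      (-(1 / (2 * π)) * (φ τ * ‖deriv (fun σ => toComplex (x σ)) τ‖)) := by
  ext τ
  rw [singleLayerIntegrand, green, hx.norm_deriv_eq, ← map_sub, toComplex.norm_map,
    norm_sub_rev]
  ring

lemma integral_kernelP_mul_norm (hx : IsAnalyticJordanParam x) (U : Plane → Plane → ℝ) (t : ℝ) :
    ∫ τ in (0 : ℝ)..(2 * π), kernelP x U τ t * ‖deriv x τ‖ =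
      -(1 / (2 * π)) * ∫ τ in (0 : ℝ)..(2 * π),
        angleKernel (fun σ => toComplex (x σ)) t τ * U (x τ) (x t) := by
  rw [← intervalIntegral.integral_const_mul]
  refine intervalIntegral.integral_congr_ae ?_
  -- The diagonal parameters, where `angleKernel` has no meaningful value, form a null set.
  filter_upwards [(countable_sameParam t).ae_notMem volume] with τ hτ _
  rw [hx.kernelP_of_not_sameParam hτ, hx.norm_deriv_eq]
  have := norm_ne_zero_iff.2 (hx.isAnalyticLoop.regular τ)
  field_simp

/-- The regularized representation of the single-layer potential on the curve. -/
lemma singleLayer_eq (hx : IsAnalyticJordanParam x) {φ : ℝ → ℝ} (hφ : Continuous φ)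
    {U : Plane → Plane → ℝ} {t : ℝ}
    {F : ℂ → ℂ} (hF : Differentiable ℂ F) (hUF : ∀ v, U v (x t) = (F (toComplex v)).re) :
    singleLayer x φ t = dirichletTrace x U t t / 2 +
      ∫ τ in (0 : ℝ)..(2 * π), (kernelP x U τ t + kernelQ x φ U τ t) * ‖deriv x τ‖ := by
  have hz := hx.isAnalyticLoop
  have hgreen := hz.integral_log_norm_sub_mul (hx.totalAngle_eq_pi t) hF
  have hP := hx.integral_kernelP_mul_norm U t
  simp only [hUF] at hP
  have hnorm : Continuous fun τ => ‖deriv x τ‖ := by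
    simp only [hx.norm_deriv_eq]
    exact hz.continuous_deriv.norm
  have hPc : Continuous fun τ => kernelP x U τ t * ‖deriv x τ‖ :=
    (continuous_iff_continuousAt.2 fun τ => (hx.analyticAt_kernelP
      (hx.analyticAt_dirichletTrace hF hUF) τ).continuousAt).mul hnorm
  have hNc : Continuous fun τ => neumannTrace x U τ t :=
    continuous_iff_continuousAt.2 fun τ => (hx.analyticAt_neumannTrace hF hUF τ).continuousAt
  have iQ : IntervalIntegrable (fun τ => kernelQ x φ U τ t * ‖deriv x τ‖) volume 0 (2 * π) := by
    simp only [hx.kernelQ_eq, mul_assoc]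
    exact hz.intervalIntegrable_log_norm_sub_mul
      (f := fun τ => 1 / (2 * π) * ((neumannTrace x U τ t - φ τ) * ‖deriv x τ‖)) (by fun_prop) t _ _
  have iN : IntervalIntegrable (fun τ => log ‖toComplex (x τ) - toComplex (x t)‖ *
      (deriv F (toComplex (x τ)) * deriv (fun σ => toComplex (x σ)) τ).im) volume 0 (2 * π) := by
    simp only [← hx.neumannTrace_mul_norm hF hUF, ← hx.norm_deriv_eq]
    exact hz.intervalIntegrable_log_norm_sub_mul
      (f := fun τ => neumannTrace x U τ t * ‖deriv x τ‖) (by fun_prop) t _ _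
  -- This is the splitting φ = Q + (φ - Q); Green's identity then handles the part with Q.
  have hsplit : singleLayer x φ t = (∫ τ in (0 : ℝ)..(2 * π), kernelQ x φ U τ t * ‖deriv x τ‖) +
      -(1 / (2 * π)) * ∫ τ in (0 : ℝ)..(2 * π), log ‖toComplex (x τ) - toComplex (x t)‖ *
        (deriv F (toComplex (x τ)) * deriv (fun σ => toComplex (x σ)) τ).im := by
    rw [← intervalIntegral.integral_const_mul, ← intervalIntegral.integral_add iQ
      (iN.const_mul _), singleLayer, hx.singleLayerIntegrand_eq]
    refine integral_congr fun τ _ => ?_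
    simp only [hx.kernelQ_eq, ← hx.neumannTrace_mul_norm hF hUF, hx.norm_deriv_eq]
    ring
  simp only [add_mul]
  rw [intervalIntegral.integral_add (hPc.intervalIntegrable _ _) iQ, hP, hsplit, hgreen,
    dirichletTrace, hUF]
  have := pi_pos.ne'
  field_simp
  ring

end IsAnalyticJordanParam
end LayerPotential
end

theorem lemma2p2
    (x : ℝ → LayerPotential.Plane) (hx : LayerPotential.IsAnalyticJordanParam x)
    (φ : ℝ → ℝ) (hφ : AnalyticOnNhd ℝ φ Set.univ)
    (hφper : Function.Periodic φ (2 * Real.pi))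
    (M : ℕ)
    -- only the values `U z y` with `y` on the curve matter
    (U : LayerPotential.Plane → LayerPotential.Plane → ℝ)
    (hU : ∀ t ∈ Set.Icc (0 : ℝ) (2 * Real.pi),
      InnerProductSpace.HarmonicOnNhd (fun z => U z (x t)) Set.univ)
    (hQ : ∀ t ∈ Set.Icc (0 : ℝ) (2 * Real.pi), ∀ m ≤ M,
      Filter.Tendsto
        (iteratedDeriv m (fun τ => LayerPotential.neumannTrace x U τ t - φ τ))
        (nhdsWithin t {t}ᶜ) (nhds 0)) :
    ∀ t ∈ Set.Icc (0 : ℝ) (2 * Real.pi),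
      -- the single-layer integral converges and has the regularized representation
      IntervalIntegrable (LayerPotential.singleLayerIntegrand x φ t) MeasureTheory.volume
        0 (2 * Real.pi) ∧
      LayerPotential.singleLayer x φ t =
        LayerPotential.dirichletTrace x U t t / 2 +
          ∫ τ in (0 : ℝ)..(2 * Real.pi),
            (LayerPotential.kernelP x U τ t + LayerPotential.kernelQ x φ U τ t)
              * ‖deriv x τ‖ ∧
      -- `R^{(P)}(·, t)` is analytic and periodic
      AnalyticOnNhd ℝ (fun τ => LayerPotential.kernelP x U τ t) Set.univ ∧
      Function.Periodic (fun τ => LayerPotential.kernelP x U τ t) (2 * Real.pi) ∧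
      -- `R^{(Q)}(·, t)` is `C^M` and periodic
      ContDiff ℝ M (fun τ => LayerPotential.kernelQ x φ U τ t) ∧
      Function.Periodic (fun τ => LayerPotential.kernelQ x φ U τ t) (2 * Real.pi) ∧
      -- its `(M+1)`-th derivative exists off `τ ≡ t`, is integrable over a period, and has
      -- at most a logarithmic singularity at `τ = t`
      (∀ τ, ¬ LayerPotential.SameParam τ t →
        DifferentiableAt ℝ
          (iteratedDeriv M (fun σ => LayerPotential.kernelQ x φ U σ t)) τ) ∧
      IntervalIntegrable
        (iteratedDeriv (M + 1) (fun τ => LayerPotential.kernelQ x φ U τ t))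
        MeasureTheory.volume 0 (2 * Real.pi) ∧
      Asymptotics.IsBigO (nhdsWithin t {t}ᶜ)
        (iteratedDeriv (M + 1) (fun τ => LayerPotential.kernelQ x φ U τ t))
        (fun τ => Real.log |τ - t|) := by
  intro t ht
  have hz := hx.isAnalyticLoop
  obtain ⟨F, hF, hUF⟩ := LayerPotential.exists_entire_re_eq (hU t ht)
  have hφc : Continuous φ :=
    continuous_iff_continuousAt.2 fun τ => (hφ τ (Set.mem_univ τ)).continuousAt
  have hdiff : ∀ τ, AnalyticAt ℝ (fun σ => LayerPotential.neumannTrace x U σ t - φ σ) τ :=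
    fun τ => (hx.analyticAt_neumannTrace hF hUF τ).sub (hφ τ (Set.mem_univ τ))
  set ψ : ℝ → ℝ := fun τ => (1 / (2 * Real.pi)) * (LayerPotential.neumannTrace x U τ t - φ τ)
    with hψdef
  have hψ : ∀ τ, AnalyticAt ℝ ψ τ := fun τ => analyticAt_const.mul (hdiff τ)
  have hψper : Function.Periodic ψ (2 * Real.pi) := fun τ => by
    have := hx.periodic_neumannTrace U t τ
    simp only at this
    simp only [hψdef, this, hφper τ]
  -- The trace difference is analytic, so the limits in the hypothesis are its derivatives at t.
  have hψ0 : ∀ m ≤ M, iteratedDeriv m ψ t = 0 := fun m hm => by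
    have h1 := tendsto_nhds_unique (hQ t ht m hm)
      ((LayerPotential.analyticAt_iteratedDeriv (hdiff t) m).continuousAt.tendsto.mono_left
        nhdsWithin_le_nhds)
    rw [hψdef, iteratedDeriv_const_mul_field, ← h1, mul_zero]
  have hker : (fun τ => LayerPotential.kernelQ x φ U τ t) = fun τ =>
      Real.log ‖LayerPotential.toComplex (x τ) - LayerPotential.toComplex (x t)‖ * ψ τ :=
    funext fun τ => hx.kernelQ_eq φ U τ t
  refine ⟨?_, hx.singleLayer_eq hφc hF hUF,
    fun τ _ => hx.analyticAt_kernelP (hx.analyticAt_dirichletTrace hF hUF) τ,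
    hx.periodic_kernelP U t, ?_, ?_, ?_, ?_, ?_⟩
  · rw [hx.singleLayerIntegrand_eq]
    have := hz.continuous_deriv
    exact hz.intervalIntegrable_log_norm_sub_mul (by fun_prop) t _ _
  · rw [hker]
    exact hz.contDiff_log_norm_sub_mul hψ hψper hψ0
  · rw [hker]
    intro τ
    simp only [hx.periodic τ, hψper τ]
  · intro τ hτ
    rw [hker]
    exact (LayerPotential.analyticAt_iteratedDeriv ((hz.analyticAt_log_norm_sub fun h =>
      hτ (hz.eq_iff.1 h)).mul (hψ τ)) M).differentiableAt
  · rw [hker]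
    refine LayerPotential.intervalIntegrable_of_locallyIntegrable
      (LayerPotential.locallyIntegrable_of_isBigO_log ?_
        (hz.isBigO_iteratedDeriv_log_norm_sub_mul hψ hψper hψ0)) _ _
    -- Measurability is free, since `deriv` of any real function is measurable.
    rw [iteratedDeriv_succ]
    exact measurable_deriv _
  · rw [hker]
    simp only [Real.log_abs]
    exact hz.isBigO_iteratedDeriv_log_norm_sub_mul hψ hψper hψ0 t
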